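/- \textbf{Definitions.} A \emph{tree walk} of size $m$ and length $k$ is a closed walk with $k$ steps on the complete graph with vertex set $\{1,\dots,m\}$ (with any starting vertex) that visits every vertex and whose set of traversed edges forms a tree on $\{1,\dots,m\}$. Let $w_{m,k}$ be the number of such walks (so $w_{1,0}=1$, $w_{0,k}=0$ for all $k$, and $w_{1,2\ell}=0$ for $\ell\ge 1$), and put \[ m_{2\ell}(\mu^c)=\sum_{m=0}^{\ell+1}\frac{w_{m,2\ell}}{m!}\,c^{-(\ell+1-m)},\qquad M_{\mu^c}(z)=\sum_{\ell\ge 0} m_{2\ell}(\mu^c)\,z^{2\ell}. \] For a polynomial $p$ with $p(0)=1$ let $M_{\mu^p}(z)=M_{\mu^c}\big(z/\sqrt{p(1/c)}\big)$, so that $M_{\mu^p}(\sqrt z)=\sum_{\ell\ge0} m_{2\ell}(\mu^c)\,p(1/c)^{-\ell}z^\ell$ is a formal power series in $z$ whose coefficients are formal power series in $1/c$. Let $C(z)=\frac{1-\sqrt{1-4z}}{2z}$ be the generating function of the Catalan numbers. For real $c>0$ and a polynomial $p$ with $p(1/c)>0$ let $\mu^p_n$ be the mean, over the binomial random graph $G(n,c/n)$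 (for $n\ge c$), of the spectral measure $\frac1n\sum_{\lambda}\delta_\lambda$, the sum running over the eigenvalues, with multiplicity, of $(c\,p(1/c))^{-1/2}A(G(n,c/n))$, where $A$ is the adjacency matrix. \textbf{Proposition.} (a) For every real $c>0$, every real polynomial $p$ with $p(1/c)>0$ and every $\ell\ge 0$, as $n\to\infty$ the moment of order $2\ell$ of $\mu^p_n$ converges to $m_{2\ell}(\mu^c)\,p(1/c)^{-\ell}$, and the moment of order $2\ell+1$ converges to $0$. In particular ($p=1$) $M_{\mu^c}$ is the generating function of the limiting moments of the spectral measures of $c^{-1/2}A(G(n,c/n))$. (b) Let $p=p_5$, where $p_5(x)=1+x+x^2+4x^3+33x^4+386x^5$. Then the coefficients $V_i(z)=[c^{-i}]\,M_{\mu^{p}}(\sqrt z)$ satisfy \[ V_i(z)=C(z)\,Q_i\big(zC(z)^2\big),\qquad i=0,1,\dots,5, \] where \begin{align*} Q_0(x)&=1,\qquad Q_1(x)=-x,\qquad Q_2(x)=-2x^3,\\ Q_3(x)&=-\left(11x^{5}+x^4-2x^3+2x^2+3x\right),\\ Q_4(x)&=-\left(90x^{7}+27x^{6}-19x^{5}+17x^4+23x^3+20x^2+26x\right),\\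 Q_5(x)&=-\left(931x^{9}+529x^{8}-163x^{7}+166x^{6}+301x^{5}+239x^4+249x^3+266x^2+324x\right). \end{align*} -/

import Mathlib

open Polynomial PowerSeries MeasureTheory Filter Topology

noncomputable section

namespace TreeWalks

/-! ### Tree walks -/

/-- A closed walk `w` on the complete graph with vertex set `Fin m`, based at `r`, is a *tree walk*
if it visits every vertex and the edges that it uses form a tree on the vertex set. -/
def IsTreeWalk {m : ℕ} {r : Fin m} (w : (⊤ : SimpleGraph (Fin m)).Walk r r) : Prop :=
  (∀ v : Fin m, v ∈ w.support) ∧ (SimpleGraph.fromEdgeSet {e | e ∈ w.edges}).IsTree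

/-- `treeWalkCount m k` is the number `w_{m,k}` of tree walks of size `m` and length `k`
(number of steps), over all starting vertices. -/
def treeWalkCount (m k : ℕ) : ℕ :=
  Nat.card {w : Σ r : Fin m, (⊤ : SimpleGraph (Fin m)).Walk r r //
    w.2.length = k ∧ IsTreeWalk w.2}

/-! ### Spectral measures of binomial random graphs -/

open Classical in
/-- The adjacency matrix of `G`, multiplied by the real number `s`. -/
def scaledAdjMatrix {n : ℕ} (s : ℝ) (G : SimpleGraph (Fin n)) : Matrix (Fin n) (Fin n) ℝ :=
  s • G.adjMatrix ℝ

theorem scaledAdjMatrix_isHermitian {n : ℕ} (s : ℝ) (G : SimpleGraph (Fin n)) :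
    (scaledAdjMatrix s G).IsHermitian := by
  classical
  ext i j
  simp [scaledAdjMatrix, SimpleGraph.adjMatrix_apply, SimpleGraph.adj_comm]

/-- The spectral measure `(1/n) ∑ δ_λ` of the scaled adjacency matrix `s A(G)`, the sum running over
its `n` eigenvalues with multiplicity. -/
def spectralMeasure {n : ℕ} (s : ℝ) (G : SimpleGraph (Fin n)) : Measure ℝ :=
  (n : ENNReal)⁻¹ • ∑ i, Measure.dirac ((scaledAdjMatrix_isHermitian s G).eigenvalues i)

/-- The mean of the spectral measure of `(c p(1/c))^{-1/2} A(G(n, c/n))`, where `G(n, c/n)` is the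
binomial random graph. The edge probability `c/n` is cut off at `1`, which only matters for the
finitely many `n < c`. -/
def meanSpectralMeasure (p : ℝ[X]) (c : ℝ) (n : ℕ) : Measure ℝ :=
  ∑ G : SimpleGraph (Fin n),
    SimpleGraph.binomialRandom (Fin n) (Set.projIcc (0 : ℝ) 1 zero_le_one (c / n)) {G} •
      spectralMeasure (Real.sqrt (c * p.eval c⁻¹))⁻¹ G

/-! ### Moment generating functions, expanded in `1/c` -/

/-- The moment `m_{2ℓ}(μ^c) = ∑_{m=0}^{ℓ+1} (w_{m,2ℓ} / m!) c^{-(ℓ+1-m)}`, a polynomial in the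
variable `1/c`. -/
def evenMoment (l : ℕ) : ℝ[X] :=
  ∑ m ∈ Finset.range (l + 2),
    Polynomial.C ((treeWalkCount m (2 * l) : ℝ) / (m.factorial : ℝ)) * Polynomial.X ^ (l + 1 - m)

/-- `M_{μ^c}(√z) = ∑_ℓ m_{2ℓ}(μ^c) z^ℓ`, as a power series in `z` (outer variable) whose
coefficients are power series in `1/c` (inner variable). -/
def momentSeries : PowerSeries (PowerSeries ℝ) :=
  PowerSeries.mk fun l => (evenMoment l : PowerSeries ℝ)

/-- `M_{μ^p}(√z) = M_{μ^c}(√(z / p(1/c)))`: the variable `z` is replaced by `z / p(1/c)`, where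
`1 / p(1/c)` is a power series in `1/c`. -/
def scaledMomentSeries (p : ℝ[X]) : PowerSeries (PowerSeries ℝ) :=
  PowerSeries.rescale ((p : PowerSeries ℝ)⁻¹) momentSeries

/-- `V_i(z) = [c^{-i}] M_{μ^p}(√z)`, a power series in `z`. -/
def V (p : ℝ[X]) (i : ℕ) : PowerSeries ℝ :=
  PowerSeries.mk fun l => PowerSeries.coeff i (PowerSeries.coeff l (scaledMomentSeries p))

/-- The generating function `C(z) = (1 - √(1 - 4z)) / (2z)` of the Catalan numbers. -/
def catalanGF : PowerSeries ℝ :=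
  PowerSeries.map (Nat.castRingHom ℝ) PowerSeries.catalanSeries

/-- The scaling polynomial `p₅`. -/
def p5 : ℝ[X] :=
  1 + Polynomial.X + Polynomial.X ^ 2 + 4 * Polynomial.X ^ 3 + 33 * Polynomial.X ^ 4
    + 386 * Polynomial.X ^ 5

/-- The polynomials `Q₀, …, Q₅`. -/
def Q : Fin 6 → ℝ[X] :=
  let x : ℝ[X] := Polynomial.X
  ![1,
    -x,
    -2 * x ^ 3,
    -(11 * x ^ 5 + x ^ 4 - 2 * x ^ 3 + 2 * x ^ 2 + 3 * x),
    -(90 * x ^ 7 + 27 * x ^ 6 - 19 * x ^ 5 + 17 * x ^ 4 + 23 * x ^ 3 + 20 * x ^ 2 + 26 * x),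
    -(931 * x ^ 9 + 529 * x ^ 8 - 163 * x ^ 7 + 166 * x ^ 6 + 301 * x ^ 5 + 239 * x ^ 4
      + 249 * x ^ 3 + 266 * x ^ 2 + 324 * x)]

end TreeWalks

end

/-! Convergence of moments is the moment method: traces of powers count closed walks, and the walks
with `m` vertices and `e` distinct edges have total weight of order `n ^ (m - e - 1)` after division
by `n`. A walk is connected, so `m ≤ e + 1`, and only tree walks survive
(`tendsto_sum_closedWalks`).

To enumerate tree walks, picture a Poisson(`c`) Galton–Watson tree and let `X` be the generating
function of closed walks at its root, so that `X = 1 / (1 - z² ∑ X_i)` over the children. The Mecke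
formula turns this into the recursion of `visitCoeff` for the moments `S_j = E X^j`, and `S_1` is
the wanted series. The proof keeps only the algebra. Expectation becomes `momentFunctional`, a
functional on polynomials in independent variables, where `X v` stands for the excursions from `v`
into the unexplored part of the tree. The recursion for the moments is then equivalent to a Palm
identity (`momentFunctional_palm`). By this identity the mean resolvent of the explored tree obeys
the recursion of a walk that follows a known edge or discovers a new vertex
(`momentFunctional_resolvent`); unrolling it gives the sum over tree walks
(`moment_one_eq_treeSum`). Working over a ring with `z ^ N = 0` keeps all sums finite.

For the expansion put `t = 1/c` and `w = z / p(t)`. The recursion becomes `S_{j+1} = S_j + w ∑ (i+j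
choose i) (t w)^i S_{i+1} S_{j+1+i}`. Because of the factor `t ^ i`, finitely many of these
equations determine `S_j` modulo `t ^ (7 - j)` (`pow_dvd_sub_of_recursion`). At `t = 0` the solution
is `C ^ j`. Since `C = 1 + x` for `x = z C²`, the ansatz `C ^ j` times a polynomial in `x` and `t`
leaves a polynomial identity (`visitPoly_succ`), and `j = 1` yields the `Q_i`. -/

namespace TreeWalks

/-! ### The moment recursion and its homogeneity. -/

section VisitCoeff

variable {A B : Type*} [CommRing A] [CommRing B]

/-- The coefficient of `Z ^ n` in the `j`-th moment of the generating function of closed walks at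
the root of a random tree. With `S j = ∑ n, visitCoeff α β n j * Z ^ n` one has `S 0 = 1` and
`S (j + 1) = S j + β Z ∑ i, (i + j).choose i * (α Z) ^ i * S (i + 1) * S (j + 1 + i)`. -/
def visitCoeff (α β : A) : ℕ → ℕ → A
  | n, 0 => if n = 0 then 1 else 0
  | n, j + 1 => visitCoeff α β n j + β * ∑ i : Fin n, ∑ a : Fin (n - i),
      ((i + j).choose i : A) * α ^ (i : ℕ) *
        (visitCoeff α β a (i + 1) * visitCoeff α β (n - 1 - i - a) (j + 1 + i))
termination_by n j => (n, j)
decreasing_by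
  all_goals simp_wf
  · exact Prod.Lex.right _ (by omega)
  · exact Prod.Lex.left _ _ (by omega)
  · exact Prod.Lex.left _ _ (by omega)

theorem visitCoeff_zero (α β : A) (n : ℕ) :
    visitCoeff α β n 0 = if n = 0 then 1 else 0 := by
  rw [visitCoeff]

theorem visitCoeff_succ (α β : A) (n j : ℕ) :
    visitCoeff α β n (j + 1) = visitCoeff α β n j + β * ∑ i : Fin n, ∑ a : Fin (n - i),
      ((i + j).choose i : A) * α ^ (i : ℕ) *
        (visitCoeff α β a (i + 1) * visitCoeff α β (n - 1 - i - a) (j + 1 + i)) := by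
  rw [visitCoeff]

/-- Each coefficient is homogeneous of degree `n` in `(α, β)`. This serves both to pass between `(1,
c)` and `(1/c, 1)` and to rescale `z` by `1 / p(1/c)`. -/
theorem visitCoeff_map (φ : A →+* B) (c : B) (α β : A) (n j : ℕ) :
    visitCoeff (c * φ α) (c * φ β) n j = c ^ n * φ (visitCoeff α β n j) := by
  induction n using Nat.strong_induction_on generalizing j with
  | _ n ihn =>
    induction j with
    | zero =>
      rw [visitCoeff_zero, visitCoeff_zero]
      split_ifs with h <;> simp [h]
    | succ j ihj =>
      rw [visitCoeff_succ, visitCoeff_succ, ihj, map_add, mul_add]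
      congr 1
      simp only [map_mul, map_sum, Finset.mul_sum]
      refine Finset.sum_congr rfl fun i _ => Finset.sum_congr rfl fun a _ => ?_
      rw [ihn a (by omega), ihn (n - 1 - i - a) (by omega)]
      obtain ⟨d, hd⟩ : ∃ d, n = 1 + i + a + d := ⟨n - 1 - i - a, by omega⟩
      rw [show n - 1 - i - a = d by omega]
      rw [show c ^ n = c ^ (1 + (i : ℕ) + a + d) from congrArg _ hd]
      simp only [map_pow, map_natCast, pow_add, mul_pow]
      ring

/-- The power series with coefficients `visitCoeff α β n j`. -/
noncomputable def visitSeries (α β : A) (j : ℕ) : PowerSeries A :=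
  PowerSeries.mk fun n => visitCoeff α β n j

theorem visitSeries_zero (α β : A) : visitSeries α β 0 = 1 := by
  ext n
  simp [visitSeries, visitCoeff_zero, PowerSeries.coeff_one]

/-- The `i`-th summand is divisible by `Z ^ (i + 1)`, so every truncation of the infinite sum at
some `N ≥ n` gives the correct coefficient of `Z ^ n`. -/
theorem coeff_visitSeries_succ (α β : A) (j : ℕ) {n N : ℕ} (h : n ≤ N) :
    PowerSeries.coeff n (visitSeries α β (j + 1)) =
      PowerSeries.coeff n (visitSeries α β j + PowerSeries.C β * PowerSeries.X *
        ∑ i ∈ Finset.range N, ((i + j).choose i : PowerSeries A) *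
          (PowerSeries.C α * PowerSeries.X) ^ i *
            (visitSeries α β (i + 1) * visitSeries α β (j + 1 + i))) := by
  have key : ∀ i, PowerSeries.coeff n (PowerSeries.C β * PowerSeries.X *
      (((i + j).choose i : PowerSeries A) * (PowerSeries.C α * PowerSeries.X) ^ i *
            (visitSeries α β (i + 1) * visitSeries α β (j + 1 + i)))) =
      if i < n then β * ∑ a : Fin (n - i),
      ((i + j).choose i : A) * α ^ (i : ℕ) *
        (visitCoeff α β a (i + 1) * visitCoeff α β (n - 1 - i - a) (j + 1 + i)) else 0 := by
    intro i
    have : PowerSeries.C β * PowerSeries.X *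
      (((i + j).choose i : PowerSeries A) * (PowerSeries.C α * PowerSeries.X) ^ i *
            (visitSeries α β (i + 1) * visitSeries α β (j + 1 + i))) =
      PowerSeries.C (β * (((i + j).choose i : A) * α ^ i)) * (PowerSeries.X ^ (i + 1) *
        (visitSeries α β (i + 1) * visitSeries α β (j + 1 + i))) := by
      simp only [map_mul, map_pow, map_natCast]
      ring
    rw [this, PowerSeries.coeff_C_mul, PowerSeries.coeff_X_pow_mul']
    by_cases hi : i < n
    · rw [if_pos (by omega : i + 1 ≤ n), if_pos hi, PowerSeries.coeff_mul,
        Finset.Nat.sum_antidiagonal_eq_sum_range_succ_mk, mul_assoc, ← Finset.mul_sum,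
        show (n - (i + 1)).succ = n - i by omega, Finset.sum_range]
      congr 2
      refine Finset.sum_congr rfl fun a _ => ?_
      simp only [visitSeries, PowerSeries.coeff_mk]
      rw [show n - (i + 1) - a = n - 1 - i - a by omega]
    · rw [if_neg (by omega), if_neg hi, mul_zero]
  rw [map_add, Finset.mul_sum, map_sum, Finset.sum_congr rfl fun i _ => key i]
  simp only [visitSeries, PowerSeries.coeff_mk]
  rw [visitCoeff_succ, Finset.mul_sum, ← Finset.sum_filter]
  congr 1
  rw [show (Finset.range N).filter (· < n) = Finset.range n by ext; simp; omega,
    Finset.sum_range]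

end VisitCoeff

/-! ### A moment functional and resolvents -/

section Moments

/-- The negative binomial series for nilpotent `w`. By Pascal's rule, multiplication by `1 - w`
lowers `j` by one, up to a boundary term in `w ^ N`. -/
theorem sum_choose_mul_pow_mul {S : Type*} [CommRing S] {w : S} {N : ℕ} (hw : w ^ N = 0) (j : ℕ) :
    (∑ i ∈ Finset.range N, ((i + j).choose i : S) * w ^ i) * (1 - w) ^ (j + 1) = 1 := by
  induction j with
  | zero =>
    have := geom_sum_mul_neg w N
    simp only [add_zero, Nat.choose_self, Nat.cast_one, one_mul, zero_add, pow_one]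
    rw [this, hw, sub_zero]
  | succ j ih =>
    have key : ∀ N : ℕ, (∑ i ∈ Finset.range N, ((i + (j + 1)).choose i : S) * w ^ i) * (1 - w) =
        (∑ i ∈ Finset.range N, ((i + j).choose i : S) * w ^ i)
          - ((N + j).choose (j + 1) : S) * w ^ N := by
      intro N
      induction N with
      | zero => simp
      | succ N ihN =>
        rw [Finset.sum_range_succ, Finset.sum_range_succ, add_mul, ihN]
        have h1 : (N + 1 + j).choose (j + 1) = (N + j).choose j + (N + j).choose (j + 1) := by
          rw [show N + 1 + j = N + j + 1 by ring, Nat.choose_succ_succ]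
        have h2 : (N + (j + 1)).choose N = (N + 1 + j).choose (j + 1) := by
          rw [Nat.choose_symm_add, show N + (j + 1) = N + 1 + j by ring]
        have h3 : (N + j).choose N = (N + j).choose j := Nat.choose_symm_add
        rw [h2, h3, h1]
        push_cast
        ring
    rw [pow_succ' (1 - w) (j + 1), ← mul_assoc, key, hw, mul_zero, sub_zero, ih]

theorem geom_sum_pow {S : Type*} [CommRing S] {w : S} {N : ℕ} (hw : w ^ N = 0) (j : ℕ) :
    (∑ i ∈ Finset.range N, w ^ i) ^ (j + 1) =
      ∑ i ∈ Finset.range N, ((i + j).choose i : S) * w ^ i := by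
  have h0 : (∑ i ∈ Finset.range N, w ^ i) * (1 - w) = 1 := by
    rw [geom_sum_mul_neg, hw, sub_zero]
  have h1 := sum_choose_mul_pow_mul hw j
  calc (∑ i ∈ Finset.range N, w ^ i) ^ (j + 1)
      = (∑ i ∈ Finset.range N, w ^ i) ^ (j + 1) *
        ((∑ i ∈ Finset.range N, ((i + j).choose i : S) * w ^ i) * (1 - w) ^ (j + 1)) := by
        rw [h1, mul_one]
    _ = ((∑ i ∈ Finset.range N, w ^ i) * (1 - w)) ^ (j + 1) *
        ∑ i ∈ Finset.range N, ((i + j).choose i : S) * w ^ i := by rw [mul_pow]; ring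
    _ = _ := by rw [h0, one_pow, one_mul]

variable {V R : Type*} [Fintype V] [CommRing R]

/-- The linear functional on polynomials that treats the variables as independent, with moments
`s`. -/
noncomputable def momentFunctional (s : ℕ → R) : MvPolynomial V R →ₗ[R] R :=
  (MvPolynomial.basisMonomials V R).constr R fun m => ∏ v, s (m v)

theorem momentFunctional_monomial (s : ℕ → R) (m : V →₀ ℕ) (a : R) :
    momentFunctional s (MvPolynomial.monomial m a) = a * ∏ v, s (m v) := by
  have h : (MvPolynomial.monomial m a : MvPolynomial V R) =
      a • MvPolynomial.basisMonomials V R m := by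
    simp [MvPolynomial.smul_monomial]
  rw [h, map_smul, momentFunctional, Module.Basis.constr_basis, smul_eq_mul]

theorem momentFunctional_prod (s : ℕ → R) (e : V → ℕ) :
    momentFunctional s (∏ v, (MvPolynomial.X v : MvPolynomial V R) ^ e v) = ∏ v, s (e v) := by
  have := momentFunctional_monomial s (Finsupp.equivFunOnFinite.symm e) (1 : R)
  rw [MvPolynomial.monomial_eq, Finsupp.prod_fintype _ _ (by simp)] at this
  simpa using this

variable [DecidableEq V]

theorem momentFunctional_split (s : ℕ → R) {u v : V} (huv : u ≠ v) (e : V → ℕ) (a b : ℕ) :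
    momentFunctional s (MvPolynomial.X v ^ a * MvPolynomial.X u ^ b *
      ∏ w ∈ (Finset.univ.erase v).erase u, (MvPolynomial.X w : MvPolynomial V R) ^ e w) =
      s a * s b * ∏ w ∈ (Finset.univ.erase v).erase u, s (e w) := by
  have h := momentFunctional_prod s (Function.update (Function.update e u b) v a)
  have hu : u ∈ (Finset.univ.erase v : Finset V) := by simp [huv]
  rw [← Finset.mul_prod_erase _ _ (Finset.mem_univ v), ← Finset.mul_prod_erase _ _ hu,
    ← Finset.mul_prod_erase _ (fun w => s _) (Finset.mem_univ v),
    ← Finset.mul_prod_erase _ (fun w => s _) hu] at h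
  simp only [Function.update_self, Function.update_of_ne huv] at h
  rw [mul_assoc, mul_assoc, ← Finset.prod_congr rfl fun w hw => ?_, h]
  · congr 2
    refine Finset.prod_congr rfl fun w hw => ?_
    simp only [Finset.mem_erase] at hw
    rw [Function.update_of_ne hw.2.1, Function.update_of_ne hw.1]
  · simp only [Finset.mem_erase] at hw
    rw [Function.update_of_ne hw.2.1, Function.update_of_ne hw.1]

/-- Set the variable `u` to `1`. -/
noncomputable def forget (R : Type*) [CommRing R] (u : V) :
    MvPolynomial V R →ₐ[R] MvPolynomial V R :=
  MvPolynomial.aeval fun w => if w = u then 1 else MvPolynomial.X w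

/-- Replace the variable `v` by `v / (1 - z² u v)`, where `z ^ N = 0`. -/
noncomputable def attach (z : R) (N : ℕ) (u v : V) :
    MvPolynomial V R →ₐ[R] MvPolynomial V R :=
  MvPolynomial.aeval fun w => if w = v then
    MvPolynomial.X v * ∑ i ∈ Finset.range N,
      (MvPolynomial.C z ^ 2 * (MvPolynomial.X v * MvPolynomial.X u)) ^ i
    else MvPolynomial.X w

omit [Fintype V] [DecidableEq V] in
theorem C_sq_mul_X_mul_X_pow_eq_zero {z : R} {N : ℕ} (hz : z ^ N = 0) (u v : V) :
    (MvPolynomial.C z ^ 2 * (MvPolynomial.X v * MvPolynomial.X u) : MvPolynomial V R) ^ N = 0 := by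
  rw [mul_pow, ← pow_mul, mul_comm 2, pow_mul, ← map_pow, hz]
  simp

/-- The algebraic form of the Mecke formula: `X v - 1` counts the nontrivial excursions from `v`,
and singling out the child `u` that begins one turns `X v` into `X v / (1 - z² X u X v)`. On a
monomial `X v ^ j * P` with `P` free of `u` and `v`, the expansion of the `(j + 1)`-st power makes
this the hypothesis `hs j`. -/
theorem momentFunctional_palm {s : ℕ → R} {z c : R} {N : ℕ} (hz : z ^ N = 0) (h0 : s 0 = 1)
    (hs : ∀ j, s (j + 1) = s j + c * z ^ 2 *
      ∑ i ∈ Finset.range N, ((i + j).choose i : R) * z ^ (2 * i) * (s (i + 1) * s (j + 1 + i)))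
    {u v : V} (huv : u ≠ v) (q : MvPolynomial V R) :
    momentFunctional s ((MvPolynomial.X v - 1) * forget R u q) =
      c * z ^ 2 * momentFunctional s
        (MvPolynomial.X u * attach z N u v (MvPolynomial.X v * forget R u q)) := by
  induction q using MvPolynomial.induction_on' with
  | add p q hp hq => simp only [map_add, mul_add, hp, hq]
  | monomial m a =>
    have hm : forget R u (MvPolynomial.monomial m a) = a • (MvPolynomial.X v ^ m v *
        ∏ w ∈ (Finset.univ.erase v).erase u, (MvPolynomial.X w : MvPolynomial V R) ^ m w) := by
      have hu : u ∈ (Finset.univ.erase v : Finset V) := by simp [huv]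
      rw [forget, MvPolynomial.aeval_monomial, Finsupp.prod_fintype _ _ (by simp),
        ← Finset.mul_prod_erase _ _ (Finset.mem_univ v), ← Finset.mul_prod_erase _ _ hu,
        if_neg huv.symm, if_pos rfl, one_pow, one_mul, Algebra.smul_def]
      congr 2
      refine Finset.prod_congr rfl fun w hw => ?_
      rw [if_neg (Finset.ne_of_mem_erase hw)]
    rw [hm]
    set P := ∏ w ∈ (Finset.univ.erase v).erase u, (MvPolynomial.X w : MvPolynomial V R) ^ m w
      with hP
    have hPa : attach z N u v P = P := by
      rw [hP, map_prod]
      refine Finset.prod_congr rfl fun w hw => ?_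
      simp only [Finset.mem_erase] at hw
      rw [map_pow, attach, MvPolynomial.aeval_X, if_neg hw.2.1]
    have hXa : attach z N u v (MvPolynomial.X v) = MvPolynomial.X v * ∑ i ∈ Finset.range N,
        (MvPolynomial.C z ^ 2 * (MvPolynomial.X v * MvPolynomial.X u)) ^ i := by
      rw [attach, MvPolynomial.aeval_X, if_pos rfl]
    generalize m v = j
    have hl : (MvPolynomial.X v - 1) * (a • (MvPolynomial.X v ^ j * P)) =
        a • (MvPolynomial.X v ^ (j + 1) * MvPolynomial.X u ^ 0 * P) -
        a • (MvPolynomial.X v ^ j * MvPolynomial.X u ^ 0 * P) := by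
      simp only [Algebra.smul_def]
      ring
    have hr : MvPolynomial.X u * attach z N u v
        (MvPolynomial.X v * (a • (MvPolynomial.X v ^ j * P))) =
        a • ∑ i ∈ Finset.range N, (((i + j).choose i : R) * z ^ (2 * i)) •
          (MvPolynomial.X v ^ (j + 1 + i) * MvPolynomial.X u ^ (i + 1) * P) := by
      rw [mul_smul_comm, map_smul, ← mul_assoc, ← pow_succ', map_mul, hPa, map_pow, hXa, mul_pow,
        geom_sum_pow (C_sq_mul_X_mul_X_pow_eq_zero hz u v), mul_smul_comm, Finset.mul_sum, Finset.sum_mul,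
        Finset.mul_sum]
      congr 1
      refine Finset.sum_congr rfl fun i _ => ?_
      simp only [Algebra.smul_def, MvPolynomial.algebraMap_eq, map_mul, map_natCast, map_pow]
      ring
    rw [hl, hr, map_sub, map_smul, map_smul, map_smul, map_sum, hP]
    simp only [map_smul, momentFunctional_split s huv, smul_eq_mul, h0, hs j]
    rw [mul_one, mul_one]
    simp only [Finset.mul_sum, Finset.sum_mul, add_mul, mul_add]
    rw [add_sub_cancel_left]
    refine Finset.sum_congr rfl fun i _ => ?_
    ring

end Moments

/-! ### Walk generating functions of the explored graph. -/

section Resolvent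

variable {V R : Type*} [Fintype V] [DecidableEq V] [CommRing R]

/-- `f` assigns to each vertex `w` the generating function of the walks from `w` to `r` along the
edges in `D`, where a visit to the vertex `y` has weight `X y`, and a step has weight `z`. -/
def IsResolvent (z : R) (r : V) (D : Finset (Sym2 V)) (f : V → MvPolynomial V R) : Prop :=
  ∀ w, f w = MvPolynomial.X w * ((if w = r then 1 else 0) +
    MvPolynomial.C z * ∑ y with s(w, y) ∈ D, f y)

/-- One step along `D`, as a linear map. -/
noncomputable def stepMap (R : Type*) [CommRing R] (D : Finset (Sym2 V)) :
    (V → MvPolynomial V R) →ₗ[R] (V → MvPolynomial V R) where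
  toFun f w := MvPolynomial.X w * ∑ y with s(w, y) ∈ D, f y
  map_add' f g := by
    ext1 w
    simp [Finset.sum_add_distrib, mul_add]
  map_smul' a f := by
    ext1 w
    simp [← Finset.smul_sum]

theorem isResolvent_iff {z : R} {r : V} {D : Finset (Sym2 V)} {f : V → MvPolynomial V R} :
    IsResolvent z r D f ↔ (1 - z • stepMap R D) f = Pi.single r (MvPolynomial.X r) := by
  rw [funext_iff]
  refine forall_congr' fun w => ?_
  have : (1 - z • stepMap R D) f w =
      f w - MvPolynomial.X w * (MvPolynomial.C z * ∑ y with s(w, y) ∈ D, f y) := by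
    simp [stepMap, Algebra.smul_def]
    ring
  rw [this, sub_eq_iff_eq_add, mul_add]
  by_cases h : w = r
  · subst h; simp
  · simp [h]

theorem isUnit_one_sub_stepMap {z : R} {N : ℕ} (hz : z ^ N = 0) (D : Finset (Sym2 V)) :
    IsUnit (1 - z • stepMap R D) := by
  refine IsNilpotent.isUnit_one_sub ⟨N, ?_⟩
  rw [_root_.smul_pow, hz, zero_smul]

theorem exists_isResolvent {z : R} {N : ℕ} (hz : z ^ N = 0) (r : V) (D : Finset (Sym2 V)) :
    ∃ f, IsResolvent z r D f := by
  simp only [isResolvent_iff]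
  exact ((Module.End.isUnit_iff _).1 (isUnit_one_sub_stepMap hz D)).2 _

theorem IsResolvent.unique {z : R} {N : ℕ} (hz : z ^ N = 0) {r : V} {D : Finset (Sym2 V)}
    {f g : V → MvPolynomial V R} (hf : IsResolvent z r D f) (hg : IsResolvent z r D g) : f = g := by
  rw [isResolvent_iff] at hf hg
  exact ((Module.End.isUnit_iff _).1 (isUnit_one_sub_stepMap hz D)).1 (hf.trans hg.symm)

theorem IsResolvent.eq_zero {z : R} {r : V} {D : Finset (Sym2 V)}
    {f : V → MvPolynomial V R} (hf : IsResolvent z r D f) {u : V} (hur : u ≠ r)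
    (hu : ∀ w, s(u, w) ∉ D) : f u = 0 := by
  rw [hf u, if_neg hur, Finset.sum_eq_zero fun y hy => ?_]
  · simp
  · exact absurd (Finset.mem_filter.1 hy).2 (hu y)

/-- No walk to `r` visits the isolated vertex `u`: setting `X u = 1` gives another solution of the
same system, which has only one. -/
theorem IsResolvent.forget_eq {z : R} {N : ℕ} (hz : z ^ N = 0) {r : V} {D : Finset (Sym2 V)}
    {f : V → MvPolynomial V R} (hf : IsResolvent z r D f) {u : V} (hur : u ≠ r)
    (hu : ∀ w, s(u, w) ∉ D) (w : V) : forget R u (f w) = f w := by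
  have : IsResolvent z r D fun w => forget R u (f w) := by
    intro w
    by_cases hw : w = u
    · subst hw
      dsimp only
      rw [hf.eq_zero hur hu, if_neg hur, Finset.sum_eq_zero fun y hy => ?_]
      · simp
      · exact absurd (Finset.mem_filter.1 hy).2 (hu y)
    · dsimp only
      rw [hf w, map_mul, map_add, map_mul, map_sum]
      congr 2
      · rw [forget, MvPolynomial.aeval_X, if_neg hw]
      · split_ifs <;> simp
      · rw [forget, MvPolynomial.aeval_C, MvPolynomial.algebraMap_eq]
  exact congrFun (this.unique hz hf) w

/-- Hanging a leaf `u` on `v` inserts a geometric series of detours `v → u → v` at each visit to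
`v`, which is the substitution `attach`. A walk from `u` must first step to `v`. The functions `F`
built in this way solve the enlarged system, so uniqueness identifies them with `g`. -/
theorem IsResolvent.attach {z : R} {N : ℕ} (hz : z ^ N = 0) {r : V} {D : Finset (Sym2 V)}
    {f g : V → MvPolynomial V R} (hf : IsResolvent z r D f) {u v : V} (huv : u ≠ v) (hur : u ≠ r)
    (hu : ∀ w, s(u, w) ∉ D) (hg : IsResolvent z r (insert s(v, u) D) g) :
    g u = MvPolynomial.C z * (MvPolynomial.X u * TreeWalks.attach z N u v (f v)) := by
  set φ := TreeWalks.attach z N u v with hφ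
  set F : V → MvPolynomial V R := fun w =>
    if w = u then MvPolynomial.C z * (MvPolynomial.X u * φ (f v)) else φ (f w) with hF
  have hfv := hf v
  have hφX : ∀ w, w ≠ v → φ (MvPolynomial.X w) = MvPolynomial.X w := fun w hw => by
    rw [hφ, TreeWalks.attach, MvPolynomial.aeval_X, if_neg hw]
  have hφv : φ (MvPolynomial.X v) * (1 - MvPolynomial.C z ^ 2 *
      (MvPolynomial.X v * MvPolynomial.X u)) = MvPolynomial.X v := by
    rw [hφ, TreeWalks.attach, MvPolynomial.aeval_X, if_pos rfl, mul_assoc, geom_sum_mul_neg,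
      C_sq_mul_X_mul_X_pow_eq_zero hz, sub_zero, mul_one]
  have hφf : ∀ w, φ (f w) = φ (MvPolynomial.X w) * ((if w = r then 1 else 0) +
      MvPolynomial.C z * ∑ y with s(w, y) ∈ D, φ (f y)) := by
    intro w
    conv_lhs => rw [hf w]
    rw [map_mul, map_add, map_mul, map_sum]
    congr 2
    · split_ifs <;> simp
    · rw [hφ, TreeWalks.attach, MvPolynomial.aeval_C, MvPolynomial.algebraMap_eq]
  have hsum : ∀ w, ∑ y with s(w, y) ∈ D, F y = ∑ y with s(w, y) ∈ D, φ (f y) := by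
    intro w
    refine Finset.sum_congr rfl fun y hy => ?_
    have : y ≠ u := by
      rintro rfl
      exact hu w (Sym2.eq_swap ▸ (Finset.mem_filter.1 hy).2)
    simp only [hF, if_neg this]
  have hFres : IsResolvent z r (insert s(v, u) D) F := by
    intro w
    by_cases hwu : w = u
    · subst hwu
      have h1 : (Finset.univ.filter fun y => s(w, y) ∈ insert s(v, w) D) = {v} := by
        ext y
        simp only [Finset.mem_filter, Finset.mem_univ, true_and, Finset.mem_insert,
          Finset.mem_singleton, hu, or_false, Sym2.eq_iff]
        constructor
        · rintro (⟨h, -⟩ | h)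
          · exact absurd h huv
          · exact h
        · rintro rfl; simp
      rw [h1, Finset.sum_singleton, if_neg hur, hF]
      simp only [if_true, if_neg huv.symm]
      ring
    · by_cases hwv : w = v
      · subst hwv
        have h1 : (Finset.univ.filter fun y => s(w, y) ∈ insert s(w, u) D) =
            insert u (Finset.univ.filter fun y => s(w, y) ∈ D) := by
          ext y
          simp only [Finset.mem_filter, Finset.mem_univ, true_and, Finset.mem_insert, Sym2.eq_iff]
          constructor
          · rintro ((h | ⟨h, -⟩) | h)
            · exact Or.inl h
            · exact absurd h hwu
            · exact Or.inr h
          · rintro (rfl | h) <;> simp [*]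
        have h2 : u ∉ Finset.univ.filter fun y => s(w, y) ∈ D := by
          simp only [Finset.mem_filter, Finset.mem_univ, true_and]
          rw [Sym2.eq_swap]
          exact hu w
        rw [h1, Finset.sum_insert h2, hsum]
        have h3 := hφf w
        simp only [hF, if_true, if_neg hwu]
        set Q : MvPolynomial V R := (if w = r then 1 else 0) +
          MvPolynomial.C z * ∑ y with s(w, y) ∈ D, φ (f y) with hQ
        have h4 : φ (f w) * (1 - MvPolynomial.C z ^ 2 *
            (MvPolynomial.X w * MvPolynomial.X u)) = MvPolynomial.X w * Q := by
          rw [h3]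
          linear_combination Q * hφv
        linear_combination h4 + MvPolynomial.X w * hQ
      · have h1 : (Finset.univ.filter fun y => s(w, y) ∈ insert s(v, u) D) =
            Finset.univ.filter fun y => s(w, y) ∈ D := by
          ext y
          simp only [Finset.mem_filter, Finset.mem_univ, true_and, Finset.mem_insert, Sym2.eq_iff]
          constructor
          · rintro ((⟨h, -⟩ | ⟨h, -⟩) | h)
            · exact absurd h hwv
            · exact absurd h hwu
            · exact h
          · exact Or.inr
        rw [h1, hsum]
        simp only [hF, if_neg hwu]
        rw [hφf w, hφX w hwv]
  rw [hg.unique hz hFres, hF]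
  simp

/-- The generating functions of the walks satisfy, in mean, the recursion of a walk that moves
along a known edge or to a new vertex. -/
theorem momentFunctional_resolvent {s : ℕ → R} {z c : R} {N : ℕ} (hz : z ^ N = 0) (h0 : s 0 = 1)
    (hs : ∀ j, s (j + 1) = s j + c * z ^ 2 *
      ∑ i ∈ Finset.range N, ((i + j).choose i : R) * z ^ (2 * i) * (s (i + 1) * s (j + 1 + i)))
    {r : V} {D : Finset (Sym2 V)}
    {f g : V → MvPolynomial V R} (hf : IsResolvent z r D f) {u v : V} (huv : u ≠ v) (hur : u ≠ r)
    (hu : ∀ w, s(u, w) ∉ D) (hg : IsResolvent z r (insert s(v, u) D) g) :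
    momentFunctional s (f v) = (if v = r then 1 else 0) +
      z * ∑ y with s(v, y) ∈ D, momentFunctional s (f y) + c * z * momentFunctional s (g u) := by
  set q : MvPolynomial V R := (if v = r then 1 else 0) +
    MvPolynomial.C z * ∑ y with s(v, y) ∈ D, f y with hq
  have hfq : f v = MvPolynomial.X v * q := hf v
  have hτ : forget R u q = q := by
    rw [hq, map_add, map_mul, map_sum, Finset.sum_congr rfl fun y _ => hf.forget_eq hz hur hu y]
    congr 2
    · split_ifs <;> simp
    · rw [forget, MvPolynomial.aeval_C, MvPolynomial.algebraMap_eq]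
  have hE1 : momentFunctional s (1 : MvPolynomial V R) = 1 := by
    have := momentFunctional_prod s (fun _ : V => 0)
    simpa [h0] using this
  have hpalm := momentFunctional_palm hz h0 hs huv q
  rw [hτ] at hpalm
  have hgu : momentFunctional s (g u) =
      z * momentFunctional s (MvPolynomial.X u * TreeWalks.attach z N u v (f v)) := by
    rw [hf.attach hz huv hur hu hg, ← MvPolynomial.smul_eq_C_mul, map_smul, smul_eq_mul]
  have hqE : momentFunctional s q = (if v = r then 1 else 0) +
      z * ∑ y with s(v, y) ∈ D, momentFunctional s (f y) := by
    rw [hq, map_add, ← MvPolynomial.smul_eq_C_mul, map_smul, smul_eq_mul, map_sum]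
    congr 1
    split_ifs
    · exact hE1
    · exact map_zero _
  -- The term `q` stops at `r` or takes a known edge at once; the other term first makes an
  -- excursion to a new neighbour and is evaluated by the Palm identity.
  have : f v = q + (MvPolynomial.X v - 1) * q := by rw [hfq]; ring
  rw [hgu, this, map_add, hpalm, hqE, ← this, hfq]
  ring

end Resolvent

/-! ### Walks exploring a tree -/

section Exploration

variable {V R : Type*} [Fintype V] [DecidableEq V] [CommRing R]

-- Every newly visited vertex is reached through a new edge, so the excess of edges over vertices
-- never drops along a walk.
omit [Fintype V] in
theorem card_union_support_le {v r : V} (w : (⊤ : SimpleGraph V).Walk v r) {D : Finset (Sym2 V)}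
    {S : Finset V} (hv : v ∈ S) (hD : ∀ e ∈ D, ∀ x ∈ e, x ∈ S) :
    (S ∪ w.support.toFinset).card + D.card ≤ (D ∪ w.edges.toFinset).card + S.card := by
  induction w generalizing D S with
  | nil => simp [hv, add_comm]
  | @cons v u r h w ih =>
    have hS : S ∪ (SimpleGraph.Walk.cons h w).support.toFinset = S ∪ w.support.toFinset := by
      ext x
      simp only [SimpleGraph.Walk.support_cons, Finset.mem_union, List.mem_toFinset, List.mem_cons]
      constructor
      · rintro (h | rfl | h) <;> simp [*]
      · rintro (h | h) <;> simp [*]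
    have hDD : D ∪ (SimpleGraph.Walk.cons h w).edges.toFinset =
        insert s(v, u) D ∪ w.edges.toFinset := by
      ext x
      simp only [SimpleGraph.Walk.edges_cons, Finset.mem_union, List.mem_toFinset, List.mem_cons,
        Finset.mem_insert]
      tauto
    rw [hS, hDD]
    by_cases hu : u ∈ S
    · have h1 := ih hu hD
      have h2 : (D ∪ w.edges.toFinset).card ≤ (insert s(v, u) D ∪ w.edges.toFinset).card :=
        Finset.card_le_card (Finset.union_subset_union_left (Finset.subset_insert _ _))
      omega
    · have hvu : s(v, u) ∉ D := fun h => hu (hD _ h u (by simp))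
      have h1 := ih (D := insert s(v, u) D) (S := insert u S) (Finset.mem_insert_self _ _) (by
        intro e he x hx
        rcases Finset.mem_insert.1 he with rfl | he
        · rcases Sym2.mem_iff.1 hx with rfl | rfl <;> simp [hv]
        · exact Finset.mem_insert_of_mem (hD e he x hx))
      rw [Finset.card_insert_of_notMem hvu, Finset.card_insert_of_notMem hu] at h1
      have h2 : (S ∪ w.support.toFinset).card ≤ (insert u S ∪ w.support.toFinset).card :=
        Finset.card_le_card (Finset.union_subset_union_left (Finset.subset_insert _ _))
      omega

theorem sum_finsetWalkLength_succ (k : ℕ) (v r : V)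
    (g : Finset (Sym2 V) → Finset V → R) :
    ∑ w ∈ (⊤ : SimpleGraph V).finsetWalkLength (k + 1) v r, g w.edges.toFinset w.support.toFinset =
      ∑ u with u ≠ v, ∑ w ∈ (⊤ : SimpleGraph V).finsetWalkLength k u r,
        g (insert s(v, u) w.edges.toFinset) (insert v w.support.toFinset) := by
  rw [SimpleGraph.finsetWalkLength, Finset.sum_biUnion]
  · simp only [Finset.sum_map]
    rw [← Finset.sum_subtype_eq_sum_filter]
    refine Finset.sum_bij (fun u _ => ⟨u.1, ?_⟩) ?_ ?_ ?_ ?_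
    · have := u.2; simp at this; exact this
    · simp
    · rintro ⟨a, ha⟩ - ⟨b, hb⟩ - h
      simpa using h
    · rintro ⟨b, hb⟩ -
      exact ⟨⟨b, by simpa using hb⟩, Finset.mem_univ _, rfl⟩
    · intro u _
      refine Finset.sum_congr rfl fun w _ => ?_
      have hu : (⊤ : SimpleGraph V).Adj v u := u.2
      change g (SimpleGraph.Walk.cons hu w).edges.toFinset
        (SimpleGraph.Walk.cons hu w).support.toFinset = _
      rw [SimpleGraph.Walk.edges_cons, SimpleGraph.Walk.support_cons, List.toFinset_cons,
        List.toFinset_cons]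
  · rintro ⟨x, hx⟩ - ⟨y, hy⟩ - hxy
    rw [Function.onFun, Finset.disjoint_left]
    intro p hp hp'
    simp only [Finset.mem_map] at hp hp'
    obtain ⟨px, _, rfl⟩ := hp
    obtain ⟨py, _, h⟩ := hp'
    cases h
    simp at hxy

/-- The sum over the walks `w` from `v` to `r` of length `k` which, after the vertices in `S` and
the edges in `D`, explore a tree, with a weight that depends on the total number of vertices. -/
noncomputable def treeSum (η : ℕ → R) (r : V) (k : ℕ) (D : Finset (Sym2 V))
    (S : Finset V) (v : V) : R :=
  ∑ w ∈ (⊤ : SimpleGraph V).finsetWalkLength k v r,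
    if (D ∪ w.edges.toFinset).card + 1 = (S ∪ w.support.toFinset).card then
      η (S ∪ w.support.toFinset).card else 0

/-- The edges in `D` are not loops, have their ends in `S`, and have the right number for a tree. -/
structure IsExplored (D : Finset (Sym2 V)) (S : Finset V) : Prop where
  not_isDiag : ∀ e ∈ D, ¬ e.IsDiag
  mem : ∀ e ∈ D, ∀ x ∈ e, x ∈ S
  card : D.card + 1 = S.card

omit [Fintype V] in
theorem IsExplored.insert {D : Finset (Sym2 V)} {S : Finset V} (h : IsExplored D S) {u v : V}
    (hv : v ∈ S) (hu : u ∉ S) : IsExplored (insert s(v, u) D) (insert u S) where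
  not_isDiag e he := by
    rcases Finset.mem_insert.1 he with rfl | he
    · rw [Sym2.mk_isDiag_iff]
      rintro rfl
      exact hu hv
    · exact h.not_isDiag e he
  mem e he x hx := by
    rcases Finset.mem_insert.1 he with rfl | he
    · rcases Sym2.mem_iff.1 hx with rfl | rfl <;> simp [hv]
    · exact Finset.mem_insert_of_mem (h.mem e he x hx)
  card := by
    rw [Finset.card_insert_of_notMem fun h' => hu (h.mem _ h' u (by simp)),
      Finset.card_insert_of_notMem hu, h.card]

theorem treeSum_zero (η : ℕ → R) (r : V) {D : Finset (Sym2 V)} {S : Finset V}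
    (h : IsExplored D S) {v : V} (hv : v ∈ S) :
    treeSum η r 0 D S v = if v = r then η S.card else 0 := by
  rw [treeSum, SimpleGraph.finsetWalkLength]
  split_ifs with hvr
  · subst hvr
    have : S ∪ {v} = S := by simpa using hv
    simp [this, h.card]
  · simp

/-- A step to an old vertex along a new edge closes a cycle, and by `card_union_support_le` the tree
count cannot be restored later. Only known edges and new vertices remain. -/
theorem treeSum_succ (η : ℕ → R) (r : V) (k : ℕ) {D : Finset (Sym2 V)} {S : Finset V}
    (h : IsExplored D S) {v : V} (hv : v ∈ S) :
    treeSum η r (k + 1) D S v = (∑ y with s(v, y) ∈ D, treeSum η r k D S y) +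
      ∑ u with u ∉ S, treeSum η r k (insert s(v, u) D) (insert u S) u := by
  rw [treeSum, sum_finsetWalkLength_succ k v r fun E T =>
    if (D ∪ E).card + 1 = (S ∪ T).card then η (S ∪ T).card else 0]
  simp only [Finset.sum_filter]
  rw [← Finset.sum_add_distrib]
  refine Finset.sum_congr rfl fun u _ => ?_
  have hmem : ∀ E : Finset (Sym2 V), D ∪ insert s(v, u) E = insert s(v, u) D ∪ E := by
    intro E; ext; simp only [Finset.mem_union, Finset.mem_insert]; tauto
  have hSv : ∀ T : Finset V, S ∪ insert v T = S ∪ T := by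
    intro T; ext x; simp only [Finset.mem_union, Finset.mem_insert]
    constructor
    · rintro (h | rfl | h) <;> simp [*]
    · rintro (h | h) <;> simp [*]
  simp only [hmem, hSv]
  by_cases huS : u ∈ S
  · rw [if_neg (not_not.2 huS), add_zero]
    by_cases hD : s(v, u) ∈ D
    · have : u ≠ v := by
        rintro rfl
        exact h.not_isDiag _ hD (by simp)
      rw [if_pos this, if_pos hD, Finset.insert_eq_of_mem hD, treeSum]
    · rw [if_neg hD]
      split_ifs with huv
      · refine Finset.sum_eq_zero fun w _ => if_neg fun heq => ?_
        have := card_union_support_le w (D := insert s(v, u) D) huS (by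
          intro e he x hx
          rcases Finset.mem_insert.1 he with rfl | he
          · rcases Sym2.mem_iff.1 hx with rfl | rfl <;> assumption
          · exact h.mem e he x hx)
        rw [Finset.card_insert_of_notMem hD] at this
        have := h.card
        omega
      · rfl
  · have hD : s(v, u) ∉ D := fun h' => huS (h.mem _ h' u (by simp))
    have huv : u ≠ v := by rintro rfl; exact huS hv
    rw [if_pos huv, if_neg hD, if_pos huS, zero_add, treeSum]
    refine Finset.sum_congr rfl fun w _ => ?_
    have : insert u S ∪ w.support.toFinset = S ∪ w.support.toFinset := by
      rw [Finset.insert_union, Finset.insert_eq_of_mem]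
      simp
    rw [this]

/-- Multiplying by `z ^ (N - K)` encodes equality modulo `z ^ K`; each step of the walk costs one
power of `z`. The weights `η` and `θ` share the factor `c` of a discovery equally among the
unexplored labels, and `hcard` ensures that labels do not run out. -/
theorem momentFunctional_resolvent_eq_treeSum {s : ℕ → R} {z c : R} {N : ℕ} (hz : z ^ N = 0)
    (h0 : s 0 = 1)
    (hs : ∀ j, s (j + 1) = s j + c * z ^ 2 *
      ∑ i ∈ Finset.range N, ((i + j).choose i : R) * z ^ (2 * i) * (s (i + 1) * s (j + 1 + i)))
    {η θ : ℕ → R} (hη : ∀ m, η (m + 1) = c * θ m)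
    (hθ : ∀ m < Fintype.card V, ((Fintype.card V - m : ℕ) : R) * θ m = η m)
    (K : ℕ) (hK : K ≤ N) {r : V} {D : Finset (Sym2 V)} {S : Finset V} (h : IsExplored D S)
    (hr : r ∈ S) {v : V} (hv : v ∈ S) (hcard : S.card + K ≤ Fintype.card V)
    {f : V → MvPolynomial V R} (hf : IsResolvent z r D f) :
    z ^ (N - K) * (η S.card * momentFunctional s (f v)) =
      z ^ (N - K) * ∑ k ∈ Finset.range K, z ^ k * treeSum η r k D S v := by
  induction K generalizing D S v f with
  | zero => simp [hz]
  | succ K ih =>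
    -- `P` is the contribution of discoveries. By `momentFunctional_resolvent` it equals `c * z *
    -- momentFunctional s (g u)` for every unexplored `u`, so the sum of `θ S.card * P` over these
    -- `u` is `η S.card * P`.
    set P : R := momentFunctional s (f v) - (if v = r then 1 else 0) -
      z * ∑ y with s(v, y) ∈ D, momentFunctional s (f y) with hP
    have hNK : N - K = N - (K + 1) + 1 := by omega
    have hnew : ∀ u, u ∉ S → z ^ (N - (K + 1)) * (θ S.card * P) = z ^ (N - (K + 1)) * (z *
        ∑ k ∈ Finset.range K, z ^ k * treeSum η r k (insert s(v, u) D) (insert u S) u) := by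
      intro u hu
      obtain ⟨g, hg⟩ := exists_isResolvent hz r (insert s(v, u) D)
      have huv : u ≠ v := by rintro rfl; exact hu hv
      have hur : u ≠ r := by rintro rfl; exact hu hr
      have h1 := momentFunctional_resolvent hz h0 hs hf huv hur
        (fun w hw => hu (h.mem _ hw u (by simp))) hg
      have h2 := ih (by omega) (h.insert hv hu) (Finset.mem_insert_of_mem hr)
        (Finset.mem_insert_self u S) (by rw [Finset.card_insert_of_notMem hu]; omega) hg
      rw [Finset.card_insert_of_notMem hu, hη, hNK] at h2
      rw [hP, h1]
      linear_combination h2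
    have hold : ∀ y, s(v, y) ∈ D → z ^ (N - (K + 1)) * (z * (η S.card * momentFunctional s (f y))) =
        z ^ (N - (K + 1)) * (z * ∑ k ∈ Finset.range K, z ^ k * treeSum η r k D S y) := by
      intro y hy
      have h2 := ih (by omega) h hr (h.mem _ hy y (by simp)) (by omega) hf
      rw [hNK] at h2
      linear_combination h2
    have hrec : ∑ k ∈ Finset.range (K + 1), z ^ k * treeSum η r k D S v =
        (if v = r then η S.card else 0) +
        (∑ y with s(v, y) ∈ D, z * ∑ k ∈ Finset.range K, z ^ k * treeSum η r k D S y) +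
        ∑ u with u ∉ S, z *
          ∑ k ∈ Finset.range K, z ^ k * treeSum η r k (insert s(v, u) D) (insert u S) u := by
      rw [Finset.sum_range_succ', treeSum_zero η r h hv, pow_zero, one_mul, add_comm, add_assoc]
      congr 1
      simp only [treeSum_succ η r _ h hv, mul_add, Finset.mul_sum, Finset.sum_add_distrib]
      congr 1
      · rw [Finset.sum_comm]
        refine Finset.sum_congr rfl fun _ _ => Finset.sum_congr rfl fun _ _ => by ring
      · rw [Finset.sum_comm]
        refine Finset.sum_congr rfl fun _ _ => Finset.sum_congr rfl fun _ _ => by ring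
    have hcompl : ((Finset.univ.filter fun u => u ∉ S).card : R) * θ S.card = η S.card := by
      have : (Finset.univ.filter fun u => u ∉ S) = Sᶜ := by ext; simp
      rw [this, Finset.card_compl]
      exact hθ _ (by omega)
    rw [hrec, mul_add, mul_add, Finset.mul_sum, Finset.mul_sum,
      ← Finset.sum_congr rfl fun y hy => hold y (Finset.mem_filter.1 hy).2,
      ← Finset.sum_congr rfl fun u hu => hnew u (Finset.mem_filter.1 hu).2,
      Finset.sum_const, nsmul_eq_mul]
    have hE : momentFunctional s (f v) = P + (if v = r then 1 else 0) +
      z * ∑ y with s(v, y) ∈ D, momentFunctional s (f y) := by rw [hP]; ring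
    have hsum : ∑ y with s(v, y) ∈ D, z ^ (N - (K + 1)) *
        (z * (η S.card * momentFunctional s (f y))) = z ^ (N - (K + 1)) * (z * (η S.card *
          ∑ y with s(v, y) ∈ D, momentFunctional s (f y))) := by
      simp only [Finset.mul_sum]
    have hite : (if v = r then η S.card else 0) = η S.card * (if v = r then 1 else 0) := by
      simp
    rw [hsum, hE, hite]
    linear_combination -(z ^ (N - (K + 1)) * P) * hcompl

/-- The first moment is the generating function of the closed walks that explore a tree. -/
theorem moment_one_eq_treeSum {s : ℕ → R} {z c : R} {N : ℕ} (hz : z ^ N = 0) (h0 : s 0 = 1)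
    (hs : ∀ j, s (j + 1) = s j + c * z ^ 2 *
      ∑ i ∈ Finset.range N, ((i + j).choose i : R) * z ^ (2 * i) * (s (i + 1) * s (j + 1 + i)))
    {η θ : ℕ → R} (hη : ∀ m, η (m + 1) = c * θ m)
    (hθ : ∀ m < Fintype.card V, ((Fintype.card V - m : ℕ) : R) * θ m = η m)
    (hcard : N < Fintype.card V) (r : V) :
    η 1 * s 1 = ∑ k ∈ Finset.range N, z ^ k * treeSum η r k ∅ {r} r := by
  obtain ⟨f, hf⟩ := exists_isResolvent hz r (∅ : Finset (Sym2 V))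
  have h : IsExplored (∅ : Finset (Sym2 V)) {r} := ⟨by simp, by simp, by simp⟩
  have := momentFunctional_resolvent_eq_treeSum hz h0 hs hη hθ N le_rfl h
    (Finset.mem_singleton_self r) (Finset.mem_singleton_self r) (by simp; omega) hf
  have hfr : momentFunctional s (f r) = s 1 := by
    have h1 := momentFunctional_prod (R := R) s (Pi.single r 1 : V → ℕ)
    rw [Finset.prod_eq_single r (fun w _ hw => by simp [hw]) (by simp),
      Finset.prod_eq_single r (fun w _ hw => by simp [hw, h0]) (by simp)] at h1
    rw [hf r]
    simpa using h1
  simpa [hfr] using this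

end Exploration

/-! ### Counting closed walks by their numbers of vertices and edges -/

section Counting

/-- The closed walks of length `k` on the complete graph. -/
def closedWalks (V : Type*) [Fintype V] [DecidableEq V] (k : ℕ) :
    Finset (Σ r : V, (⊤ : SimpleGraph V).Walk r r) :=
  Finset.univ.sigma fun r => (⊤ : SimpleGraph V).finsetWalkLength k r r

/-- The number of closed walks of length `k` on the complete graph on `Fin m` that visit all
vertices and use `e` different edges. -/
def coveringWalkCount (m e k : ℕ) : ℕ :=
  ((closedWalks (Fin m) k).filter fun w =>
    w.2.support.toFinset = Finset.univ ∧ w.2.edges.toFinset.card = e).card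

theorem exists_map_hom {V W : Type*} (f : (⊤ : SimpleGraph V) →g (⊤ : SimpleGraph W)) {a b : W}
    (w : (⊤ : SimpleGraph W).Walk a b) (hw : ∀ x ∈ w.support, x ∈ Set.range f) :
    ∀ u v (hu : f u = a) (hv : f v = b), ∃ w' : (⊤ : SimpleGraph V).Walk u v,
      (w'.map f).copy hu hv = w := by
  induction w with
  | @nil a =>
    rintro u v hu hv
    obtain rfl : u = v := f.injective_of_top_hom (hu.trans hv.symm)
    subst hu
    exact ⟨.nil, rfl⟩
  | @cons a y b h w ih =>
    rintro u v hu hv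
    subst hu hv
    obtain ⟨x, rfl⟩ := hw y (by simp)
    obtain ⟨w', hw'⟩ := ih (fun z hz => hw z (by simp [hz])) x v rfl rfl
    have hux : (⊤ : SimpleGraph V).Adj u x := by
      rw [SimpleGraph.top_adj]
      rintro rfl
      exact h.ne rfl
    refine ⟨.cons hux w', ?_⟩
    rw [SimpleGraph.Walk.copy_rfl_rfl] at hw' ⊢
    rw [SimpleGraph.Walk.map_cons, hw']

theorem card_edges_map_hom {V W : Type*} [DecidableEq V] [DecidableEq W]
    (f : (⊤ : SimpleGraph V) →g (⊤ : SimpleGraph W)) {u v : V} (w : (⊤ : SimpleGraph V).Walk u v) :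
    (w.map f).edges.toFinset.card = w.edges.toFinset.card := by
  have : (w.edges.map (Sym2.map f)).toFinset = w.edges.toFinset.image (Sym2.map f) := by
    ext x; simp
  rw [SimpleGraph.Walk.edges_map, this,
    Finset.card_image_of_injective _ (Sym2.map.injective f.injective_of_top_hom)]

theorem support_map_hom {V W : Type*} [DecidableEq V] [DecidableEq W]
    (f : (⊤ : SimpleGraph V) →g (⊤ : SimpleGraph W)) {u v : V} (w : (⊤ : SimpleGraph V).Walk u v) :
    (w.map f).support.toFinset = w.support.toFinset.image f := by
  rw [SimpleGraph.Walk.support_map]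
  ext x; simp

theorem exists_hom_range {m n : ℕ} {A : Finset (Fin n)} (hA : A.card = m) :
    ∃ f : (⊤ : SimpleGraph (Fin m)) →g (⊤ : SimpleGraph (Fin n)), Set.range f = A :=
  ⟨⟨A.orderEmbOfFin hA, fun h => by simpa using h⟩, A.range_orderEmbOfFin hA⟩

/-- A walk is determined by its vertex set `A` and its relabelling along a bijection of `Fin m` with
`A`. -/
theorem card_closedWalks_filter (n m e k : ℕ) :
    ((closedWalks (Fin n) k).filter fun w =>
      w.2.support.toFinset.card = m ∧ w.2.edges.toFinset.card = e).card =
      n.choose m * coveringWalkCount m e k := by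
  have hmaps : Set.MapsTo (fun w : Σ r : Fin n, (⊤ : SimpleGraph (Fin n)).Walk r r =>
      w.2.support.toFinset)
      ((closedWalks (Fin n) k).filter fun w =>
        w.2.support.toFinset.card = m ∧ w.2.edges.toFinset.card = e)
      (Finset.powersetCard m (Finset.univ : Finset (Fin n))) := by
    intro w hw
    rw [Finset.mem_coe, Finset.mem_filter] at hw
    simp [hw.2.1]
  rw [Finset.card_eq_sum_card_fiberwise hmaps]
  have hfib : ∀ A ∈ Finset.powersetCard m (Finset.univ : Finset (Fin n)),
      (((closedWalks (Fin n) k).filter fun w =>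
        w.2.support.toFinset.card = m ∧ w.2.edges.toFinset.card = e).filter
          fun w => w.2.support.toFinset = A).card = coveringWalkCount m e k := by
    intro A hA
    have hAm : A.card = m := (Finset.mem_powersetCard.1 hA).2
    obtain ⟨f, hf⟩ := exists_hom_range hAm
    have hfu : Finset.univ.image f = A := by
      apply Finset.coe_injective
      rw [Finset.coe_image, Finset.coe_univ, Set.image_univ, hf]
    symm
    refine Finset.card_bij (fun w _ => ⟨f w.1, w.2.map f⟩) ?_ ?_ ?_
    · rintro ⟨r, w⟩ hw
      simp only [Finset.mem_filter, closedWalks, Finset.mem_sigma,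
        Finset.mem_univ, true_and, SimpleGraph.mem_finsetWalkLength_iff] at hw ⊢
      obtain ⟨hk, hs, he⟩ := hw
      have h1 : (w.map f).support.toFinset = A := by
        rw [support_map_hom, hs, hfu]
      exact ⟨⟨by rw [SimpleGraph.Walk.length_map, hk], by rw [h1, hAm],
        by rw [card_edges_map_hom, he]⟩, h1⟩
    · rintro ⟨r, w⟩ - ⟨r', w'⟩ - h
      have h1 : f r = f r' := congrArg Sigma.fst h
      obtain rfl := f.injective_of_top_hom h1
      have h2 : w = w' := SimpleGraph.Walk.map_injective_of_injective f.injective_of_top_hom r r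
        (eq_of_heq (Sigma.mk.inj h).2)
      rw [h2]
    · rintro ⟨a, w⟩ hw
      simp only [closedWalks, Finset.mem_sigma,
        Finset.mem_filter, Finset.mem_univ, true_and, SimpleGraph.mem_finsetWalkLength_iff] at hw
      obtain ⟨⟨hk, hs, he⟩, hwA⟩ := hw
      have hr : ∀ x ∈ w.support, x ∈ Set.range f := by
        intro x hx
        rw [hf, ← hwA]
        simpa using hx
      obtain ⟨r, rfl⟩ := hr a w.start_mem_support
      obtain ⟨w', hw'⟩ := exists_map_hom f w hr r r rfl rfl
      rw [SimpleGraph.Walk.copy_rfl_rfl] at hw'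
      subst hw'
      refine ⟨⟨r, w'⟩, ?_, rfl⟩
      simp only [closedWalks, Finset.mem_sigma, Finset.mem_filter,
        Finset.mem_univ, true_and, SimpleGraph.mem_finsetWalkLength_iff]
      refine ⟨by rw [← hk, SimpleGraph.Walk.length_map], ?_, by rw [← he, card_edges_map_hom]⟩
      rw [support_map_hom, Finset.card_image_of_injective _ f.injective_of_top_hom] at hs
      rw [← Finset.card_eq_iff_eq_univ, hs, Fintype.card_fin]
  rw [Finset.sum_congr rfl hfib, Finset.sum_const, Finset.card_powersetCard, Finset.card_univ,
    Fintype.card_fin, smul_eq_mul]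

theorem sum_closedWalks {R : Type*} [CommSemiring R] (n k : ℕ) (g : ℕ → ℕ → R) :
    ∑ w ∈ closedWalks (Fin n) k, g w.2.support.toFinset.card w.2.edges.toFinset.card =
      ∑ m ∈ Finset.range (k + 2), ∑ e ∈ Finset.range (k + 1),
        ((n.choose m * coveringWalkCount m e k : ℕ) : R) * g m e := by
  rw [← Finset.sum_product', ← Finset.sum_fiberwise_of_maps_to
    (g := fun w => (w.2.support.toFinset.card, w.2.edges.toFinset.card))
    (t := Finset.range (k + 2) ×ˢ Finset.range (k + 1))]
  · refine Finset.sum_congr rfl fun x _ => ?_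
    rw [← card_closedWalks_filter, ← nsmul_eq_mul, ← Finset.sum_const]
    refine Finset.sum_congr (by simp [Prod.ext_iff]) fun w hw => ?_
    simp only [Finset.mem_filter] at hw
    rw [hw.2.1, hw.2.2]
  · rintro ⟨r, w⟩ hw
    simp only [closedWalks, Finset.mem_sigma, Finset.mem_univ, true_and,
      SimpleGraph.mem_finsetWalkLength_iff] at hw
    have h1 := w.support.toFinset_card_le
    have h2 := w.edges.toFinset_card_le
    rw [SimpleGraph.Walk.length_support] at h1
    rw [SimpleGraph.Walk.length_edges] at h2
    simp only [Finset.mem_product, Finset.mem_range]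
    omega

theorem coveringWalkCount_eq_zero {m e : ℕ} (h : e + 1 < m) (k : ℕ) :
    coveringWalkCount m e k = 0 := by
  rw [coveringWalkCount, Finset.card_eq_zero, Finset.filter_eq_empty_iff]
  rintro ⟨r, w⟩ - ⟨hs, he⟩
  have := card_union_support_le w (D := ∅) (S := {r}) (Finset.mem_singleton_self r) (by simp)
  rw [hs, Finset.union_eq_right.2 (Finset.subset_univ _), Finset.card_univ, Fintype.card_fin,
    Finset.card_empty, Finset.empty_union, Finset.card_singleton, he] at this
  omega

/-- The edges of a walk through all vertices form a connected graph, so being a tree is a matter of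
counting them. -/
theorem isTreeWalk_iff {m : ℕ} {r : Fin m} (w : (⊤ : SimpleGraph (Fin m)).Walk r r) :
    IsTreeWalk w ↔ w.support.toFinset = Finset.univ ∧ w.edges.toFinset.card + 1 = m := by
  have h1 : (∀ v, v ∈ w.support) ↔ w.support.toFinset = Finset.univ := by
    simp [Finset.ext_iff]
  rw [IsTreeWalk, h1]
  refine and_congr_right fun hs => ?_
  have hedge : (SimpleGraph.fromEdgeSet {e | e ∈ w.edges}).edgeSet = w.edges.toFinset := by
    rw [SimpleGraph.edgeSet_fromEdgeSet]
    ext e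
    simp only [Set.mem_sdiff, Set.mem_ofPred_eq, List.coe_toFinset, and_iff_left_iff_imp]
    intro he
    exact SimpleGraph.not_isDiag_of_mem_edgeSet _ (w.edges_subset_edgeSet he)
  have hcard : Nat.card (SimpleGraph.fromEdgeSet {e | e ∈ w.edges}).edgeSet =
      w.edges.toFinset.card := by
    rw [hedge, Nat.card_coe_set_eq, Set.ncard_coe_finset]
  rw [SimpleGraph.isTree_iff_connected_and_card, hcard, Nat.card_eq_fintype_card, Fintype.card_fin]
  refine and_iff_right ?_
  have hle : ∀ e ∈ w.edges, e ∈ (SimpleGraph.fromEdgeSet {e | e ∈ w.edges}).edgeSet := by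
    intro e he
    rw [hedge]
    simpa using he
  let w' := w.transfer _ hle
  have hreach : ∀ x, (SimpleGraph.fromEdgeSet {e | e ∈ w.edges}).Reachable r x := by
    intro x
    have hx : x ∈ w'.support := by
      rw [SimpleGraph.Walk.support_transfer, ← List.mem_toFinset, hs]
      exact Finset.mem_univ x
    exact ⟨w'.takeUntil x hx⟩
  have : Nonempty (Fin m) := ⟨r⟩
  exact ⟨fun x y => (hreach x).symm.trans (hreach y)⟩

theorem treeWalkCount_succ (m k : ℕ) : treeWalkCount (m + 1) k = coveringWalkCount (m + 1) m k := by
  rw [treeWalkCount, coveringWalkCount]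
  refine Nat.subtype_card _ ?_
  rintro ⟨r, w⟩
  simp only [closedWalks, Finset.mem_filter, Finset.mem_sigma, Finset.mem_univ, true_and,
    SimpleGraph.mem_finsetWalkLength_iff, isTreeWalk_iff, Nat.add_right_cancel_iff]

theorem treeWalkCount_zero (k : ℕ) : treeWalkCount 0 k = 0 := by
  rw [treeWalkCount, Nat.card_eq_zero]
  exact Or.inl ⟨fun w => w.1.1.elim0⟩

theorem sum_closedWalks_tree {R : Type*} [CommSemiring R] (n k : ℕ) (g : ℕ → R) :
    ∑ w ∈ closedWalks (Fin n) k, (if w.2.edges.toFinset.card + 1 = w.2.support.toFinset.card then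
      g w.2.support.toFinset.card else 0) =
      ∑ m ∈ Finset.range (k + 2), ((n.choose m * treeWalkCount m k : ℕ) : R) * g m := by
  rw [sum_closedWalks n k fun m e => if e + 1 = m then g m else 0]
  refine Finset.sum_congr rfl fun m hm => ?_
  cases m with
  | zero => simp [treeWalkCount_zero]
  | succ m =>
    rw [Finset.sum_eq_single m]
    · rw [if_pos rfl, treeWalkCount_succ]
    · intro e _ he
      rw [if_neg (by omega), mul_zero]
    · intro h
      simp at hm h
      omega

end Counting

/-! ### The generating function of tree walks -/

section GeneratingFunction

/-- The exploration identity is applied over `ℝ⟦z⟧ / (z ^ (k + 1))` on `k + 2` labels, enough for a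
walk of length `k` with all its vertices distinct. Summing over the roots gives both sides a factor
`n`, which cancels. -/
theorem sum_treeWalkCount_eq_coeff {c : ℝ} (hc : c ≠ 0) (k : ℕ) :
    ∑ m ∈ Finset.range (k + 2), (treeWalkCount m k : ℝ) / m.factorial * (c⁻¹ * c ^ m) =
      PowerSeries.coeff k (PowerSeries.expand 2 two_ne_zero (visitSeries 1 c 1)) := by
  set N := k + 1 with hN
  set n := N + 1 with hn
  let I : Ideal (PowerSeries ℝ) := Ideal.span {PowerSeries.X ^ N}
  let R := PowerSeries ℝ ⧸ I
  let π : PowerSeries ℝ →+* R := Ideal.Quotient.mk I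
  let φ : PowerSeries ℝ →+* PowerSeries ℝ :=
    (PowerSeries.expand 2 two_ne_zero : PowerSeries ℝ →ₐ[ℝ] PowerSeries ℝ).toRingHom
  have hφX : φ PowerSeries.X = PowerSeries.X ^ 2 := PowerSeries.expand_X _ _
  have hφC : ∀ a : ℝ, φ (PowerSeries.C a) = PowerSeries.C a := PowerSeries.expand_C _ _
  have hπ : ∀ f g : PowerSeries ℝ, (∀ i < N, PowerSeries.coeff i f = PowerSeries.coeff i g) ↔
      π f = π g := by
    intro f g
    rw [Ideal.Quotient.eq, Ideal.mem_span_singleton, PowerSeries.X_pow_dvd_iff]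
    simp only [map_sub, sub_eq_zero]
  have hz : π PowerSeries.X ^ N = 0 := by
    rw [← map_pow]
    exact Ideal.Quotient.eq_zero_iff_mem.2 (Ideal.mem_span_singleton_self _)
  let s : ℕ → R := fun j => π (φ (visitSeries 1 c j))
  have h0 : s 0 = 1 := by simp only [s, visitSeries_zero, map_one]
  have hs : ∀ j, s (j + 1) = s j + π (PowerSeries.C c) * π PowerSeries.X ^ 2 *
      ∑ i ∈ Finset.range N, ((i + j).choose i : R) * π PowerSeries.X ^ (2 * i) *
        (s (i + 1) * s (j + 1 + i)) := by
    intro j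
    have h1 : π (φ (visitSeries 1 c (j + 1))) = π (φ (visitSeries 1 c j +
        PowerSeries.C c * PowerSeries.X * ∑ i ∈ Finset.range N,
          ((i + j).choose i : PowerSeries ℝ) * (PowerSeries.C 1 * PowerSeries.X) ^ i *
            (visitSeries 1 c (i + 1) * visitSeries 1 c (j + 1 + i)))) := by
      refine (hπ _ _).1 fun i hi => ?_
      change PowerSeries.coeff i (PowerSeries.expand 2 two_ne_zero _) =
        PowerSeries.coeff i (PowerSeries.expand 2 two_ne_zero _)
      rw [PowerSeries.coeff_expand, PowerSeries.coeff_expand]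
      split_ifs
      · exact coeff_visitSeries_succ 1 c j (by omega)
      · rfl
    simp only [s, h1, map_add, map_mul, map_sum, map_pow, map_natCast, hφX, hφC, map_one, one_mul,
      ← pow_mul]
  -- These solve the two weight relations with `η 1 = 1`: discovering `m - 1` further labels gives
  -- `c ^ (m - 1)` divided by `(n - 1) ⋯ (n - m + 1)`. Multiplied by `n.choose m`, this becomes `n *
  -- c ^ (m - 1) / m!`.
  let θ : ℕ → ℝ := fun m => c⁻¹ * c ^ m * ((n - (m + 1)).factorial / (n - 1).factorial : ℝ)
  let η : ℕ → ℝ := fun m => c⁻¹ * c ^ m * ((n - m).factorial / (n - 1).factorial : ℝ)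
  have hη : ∀ m, π (PowerSeries.C (η (m + 1))) = π (PowerSeries.C c) * π (PowerSeries.C (θ m)) := by
    intro m
    rw [← map_mul, ← map_mul]
    congr 2
    simp only [η, θ, pow_succ]
    ring
  have hθ : ∀ m < Fintype.card (Fin n), ((Fintype.card (Fin n) - m : ℕ) : R) *
      π (PowerSeries.C (θ m)) = π (PowerSeries.C (η m)) := by
    intro m hm
    rw [Fintype.card_fin] at hm ⊢
    rw [← map_natCast π, ← map_natCast (PowerSeries.C (R := ℝ)), ← map_mul, ← map_mul]
    congr 2
    simp only [η, θ]
    obtain ⟨d, hd⟩ : ∃ d, n - m = d + 1 := ⟨n - m - 1, by omega⟩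
    rw [hd, show n - (m + 1) = d by omega, Nat.factorial_succ]
    push_cast
    ring
  have hη1 : η 1 = 1 := by
    have : ((n - 1).factorial : ℝ) ≠ 0 := Nat.cast_ne_zero.2 (Nat.factorial_ne_zero _)
    simp only [η, pow_one]
    rw [inv_mul_cancel₀ hc, div_self this, one_mul]
  have hmain := fun r : Fin n => moment_one_eq_treeSum (V := Fin n) hz h0 hs hη hθ
    (by rw [Fintype.card_fin]; omega) r
  have hsum : ∀ k < N, ∑ r : Fin n, treeSum (fun m => π (PowerSeries.C (η m))) r k ∅ {r} r =
      π (PowerSeries.C ((n : ℝ) * ∑ m ∈ Finset.range (k + 2),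
        (treeWalkCount m k : ℝ) / m.factorial * (c⁻¹ * c ^ m))) := by
    intro k hk
    have h1 := sum_closedWalks_tree n k η
    have h2 : ∑ r : Fin n, treeSum (fun m => π (PowerSeries.C (η m))) r k ∅ {r} r =
        π (PowerSeries.C (∑ w ∈ closedWalks (Fin n) k,
          (if w.2.edges.toFinset.card + 1 = w.2.support.toFinset.card then
          η w.2.support.toFinset.card else 0))) := by
      rw [closedWalks, Finset.sum_sigma, map_sum, map_sum]
      refine Finset.sum_congr rfl fun r _ => ?_
      rw [treeSum, map_sum, map_sum]
      refine Finset.sum_congr rfl fun w _ => ?_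
      have h3 : {r} ∪ w.support.toFinset = w.support.toFinset := by simp
      rw [h3, Finset.empty_union]
      split_ifs <;> simp
    rw [h2, h1, Finset.mul_sum]
    congr 2
    refine Finset.sum_congr rfl fun m hm => ?_
    have hmn : m ≤ n := by
      rw [Finset.mem_range] at hm
      omega
    have h4 := Nat.choose_mul_factorial_mul_factorial hmn
    have h5 : n.factorial = n * (n - 1).factorial :=
      (Nat.mul_factorial_pred (by omega)).symm
    have h6 : ((n.choose m : ℝ) * m.factorial * (n - m).factorial) = n * (n - 1).factorial := by
      rw [← Nat.cast_mul, ← Nat.cast_mul, ← Nat.cast_mul, h4, h5]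
    have h7 : (m.factorial : ℝ) ≠ 0 := Nat.cast_ne_zero.2 (Nat.factorial_ne_zero _)
    have h8 : ((n - 1).factorial : ℝ) ≠ 0 := Nat.cast_ne_zero.2 (Nat.factorial_ne_zero _)
    simp only [η]
    push_cast
    field_simp
    linear_combination (treeWalkCount m k : ℝ) * h6
  have htot : π (PowerSeries.C (n : ℝ)) * s 1 = π (PowerSeries.C (n : ℝ) *
      ∑ k ∈ Finset.range N, PowerSeries.X ^ k * PowerSeries.C (∑ m ∈ Finset.range (k + 2),
        (treeWalkCount m k : ℝ) / m.factorial * (c⁻¹ * c ^ m))) := by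
    have h1 : ∑ r : Fin n, π (PowerSeries.C (η 1)) * s 1 = π (PowerSeries.C (n : ℝ)) * s 1 := by
      rw [Finset.sum_const, hη1, Finset.card_univ, Fintype.card_fin, nsmul_eq_mul, map_one, map_one,
        one_mul]
      simp
    rw [← h1, Finset.sum_congr rfl fun r _ => hmain r, Finset.sum_comm, map_mul, map_sum,
      Finset.mul_sum]
    refine Finset.sum_congr rfl fun k hk => ?_
    rw [← Finset.mul_sum, hsum k (Finset.mem_range.1 hk)]
    simp only [map_mul, map_pow]
    ring
  rw [← map_mul] at htot
  have := (hπ _ _).2 htot k (by omega)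
  rw [PowerSeries.coeff_C_mul, PowerSeries.coeff_C_mul] at this
  have hn0 : (n : ℝ) ≠ 0 := by positivity
  have h2 := mul_left_cancel₀ hn0 this
  change PowerSeries.coeff k (PowerSeries.expand 2 two_ne_zero _) = _ at h2
  rw [h2, map_sum (PowerSeries.coeff k)]
  symm
  refine (Finset.sum_eq_single k ?_ ?_).trans ?_
  · intro b _ hb
    rw [PowerSeries.coeff_X_pow_mul']
    split_ifs with h
    · rw [PowerSeries.coeff_C, if_neg (by omega)]
    · rfl
  · intro h
    simp at h
    omega
  · rw [PowerSeries.coeff_X_pow_mul', if_pos le_rfl, Nat.sub_self, PowerSeries.coeff_C, if_pos rfl]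

end GeneratingFunction

/-! ### Tree walk counts as polynomials in `1/c`. -/

section TreeWalkCounts

theorem sum_treeWalkCount_even {c : ℝ} (hc : c ≠ 0) (l : ℕ) :
    ∑ m ∈ Finset.range (2 * l + 2), (treeWalkCount m (2 * l) : ℝ) / m.factorial * (c⁻¹ * c ^ m) =
      c ^ l * (visitCoeff (Polynomial.X : ℝ[X]) 1 l 1).eval c⁻¹ := by
  rw [sum_treeWalkCount_eq_coeff hc, PowerSeries.coeff_expand_mul, visitSeries,
    PowerSeries.coeff_mk]
  have h := visitCoeff_map (Polynomial.evalRingHom c⁻¹) c (Polynomial.X : ℝ[X]) 1 l 1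
  rwa [Polynomial.coe_evalRingHom, Polynomial.eval_X, Polynomial.eval_one, mul_inv_cancel₀ hc,
    mul_one] at h

theorem sum_treeWalkCount_odd {c : ℝ} (hc : c ≠ 0) (l : ℕ) :
    ∑ m ∈ Finset.range (2 * l + 1 + 2),
      (treeWalkCount m (2 * l + 1) : ℝ) / m.factorial * (c⁻¹ * c ^ m) = 0 := by
  rw [sum_treeWalkCount_eq_coeff hc, PowerSeries.coeff_expand_of_not_dvd]
  omega

theorem sum_C_treeWalkCount_mul_X_pow (l : ℕ) :
    ∑ m ∈ Finset.range (2 * l + 2),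
      Polynomial.C ((treeWalkCount m (2 * l) : ℝ) / m.factorial) *
        Polynomial.X ^ (2 * l + 2 - m) =
      Polynomial.X ^ (l + 1) * visitCoeff (Polynomial.X : ℝ[X]) 1 l 1 := by
  refine Polynomial.eq_of_infinite_eval_eq _ _ ((Set.Ioi_infinite (0 : ℝ)).mono fun t ht => ?_)
  have ht0 : t ≠ 0 := ne_of_gt ht
  have h := sum_treeWalkCount_even (inv_ne_zero ht0) l
  rw [inv_inv] at h
  change Polynomial.eval _ _ = Polynomial.eval _ _
  rw [Polynomial.eval_finsetSum, Polynomial.eval_mul, Polynomial.eval_pow, Polynomial.eval_X]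
  have h2 : t ^ (l + 1) * (visitCoeff (Polynomial.X : ℝ[X]) 1 l 1).eval t =
      t ^ (2 * l + 1) * (t⁻¹ ^ l * (visitCoeff (Polynomial.X : ℝ[X]) 1 l 1).eval t) := by
    rw [show 2 * l + 1 = l + 1 + l by ring, pow_add t (l + 1) l, inv_pow]
    field_simp
  rw [h2, ← h, Finset.mul_sum]
  refine Finset.sum_congr rfl fun m hm => ?_
  rw [Polynomial.eval_mul, Polynomial.eval_C, Polynomial.eval_pow, Polynomial.eval_X]
  obtain ⟨d, hd⟩ : ∃ d, 2 * l + 1 = m + d := by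
    rw [Finset.mem_range] at hm
    exact ⟨2 * l + 1 - m, by omega⟩
  rw [show 2 * l + 2 - m = d + 1 by omega, hd, pow_add t m d, inv_pow,
    pow_succ t d]
  field_simp

/-- Combinatorially, a closed walk on a tree uses each edge at least twice. Here it is read off the
factor `X ^ (l + 1)` in `sum_C_treeWalkCount_mul_X_pow`; sizes beyond that sum exceed the number of
vertices a walk can visit. -/
theorem treeWalkCount_eq_zero_of_lt {m l : ℕ} (h : l + 1 < m) : treeWalkCount m (2 * l) = 0 := by
  by_cases hm : m < 2 * l + 2
  · have h1 := congrArg (Polynomial.coeff · (2 * l + 2 - m)) (sum_C_treeWalkCount_mul_X_pow l)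
    simp only [Polynomial.finsetSum_coeff, Polynomial.coeff_C_mul, Polynomial.coeff_X_pow] at h1
    rw [Polynomial.coeff_X_pow_mul', if_neg (by omega), Finset.sum_eq_single m] at h1
    · rw [if_pos rfl, mul_one, div_eq_zero_iff] at h1
      rcases h1 with h1 | h1
      · exact_mod_cast h1
      · exact absurd h1 (Nat.cast_ne_zero.2 (Nat.factorial_ne_zero _))
    · intro b hb hbm
      rw [Finset.mem_range] at hb
      rw [if_neg (by omega), mul_zero]
    · intro h
      simp at h
      omega
  · obtain ⟨m, rfl⟩ : ∃ m', m = m' + 1 := ⟨m - 1, by omega⟩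
    rw [treeWalkCount_succ, coveringWalkCount, Finset.card_eq_zero, Finset.filter_eq_empty_iff]
    rintro ⟨r, w⟩ hw ⟨hs, -⟩
    simp only [closedWalks, Finset.mem_sigma, Finset.mem_univ, true_and,
      SimpleGraph.mem_finsetWalkLength_iff] at hw
    have h1 := w.support.toFinset_card_le
    rw [SimpleGraph.Walk.length_support, hw, hs, Finset.card_univ, Fintype.card_fin] at h1
    omega

theorem evenMoment_eq_visitCoeff (l : ℕ) :
    evenMoment l = visitCoeff (Polynomial.X : ℝ[X]) 1 l 1 := by
  have h := sum_C_treeWalkCount_mul_X_pow l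
  have h2 : ∑ m ∈ Finset.range (2 * l + 2),
      Polynomial.C ((treeWalkCount m (2 * l) : ℝ) / m.factorial) *
        Polynomial.X ^ (2 * l + 2 - m) = Polynomial.X ^ (l + 1) * evenMoment l := by
    rw [evenMoment, Finset.mul_sum]
    symm
    refine Finset.sum_subset_zero_on_sdiff (Finset.range_mono (by omega)) ?_ ?_
    · intro m hm
      rw [Finset.mem_sdiff, Finset.mem_range, Finset.mem_range] at hm
      rw [treeWalkCount_eq_zero_of_lt (by omega)]
      simp
    · intro m hm
      rw [Finset.mem_range] at hm
      rw [show 2 * l + 2 - m = (l + 1) + (l + 1 - m) by omega, pow_add]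
      ring
  exact mul_left_cancel₀ (pow_ne_zero _ Polynomial.X_ne_zero) (h2.symm.trans h)

end TreeWalkCounts

/-! ### Moments of the mean spectral measures -/

section Spectral

theorem sum_eigenvalues_pow {n : ℕ} {A : Matrix (Fin n) (Fin n) ℝ} (hA : A.IsHermitian) (k : ℕ) :
    ∑ i, hA.eigenvalues i ^ k = (A ^ k).trace := by
  conv_rhs => rw [hA.spectral_theorem, ← map_pow, Unitary.conjStarAlgAut_apply,
    Matrix.trace_mul_comm, ← mul_assoc, Unitary.coe_star_mul_self, one_mul, Matrix.diagonal_pow,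
    Matrix.trace_diagonal]
  simp

theorem integral_pow_spectralMeasure {n : ℕ} (s : ℝ) (G : SimpleGraph (Fin n)) (k : ℕ) :
    ∫ x, x ^ k ∂(spectralMeasure s G) = (n : ℝ)⁻¹ * (scaledAdjMatrix s G ^ k).trace := by
  rw [spectralMeasure, integral_smul_measure, integral_finsetSum_measure]
  · simp [sum_eigenvalues_pow]
  · intro i _
    exact integrable_dirac (by simp)

theorem integrable_pow_spectralMeasure {n : ℕ} (hn : n ≠ 0) (s : ℝ) (G : SimpleGraph (Fin n))
    (k : ℕ) : Integrable (fun x => x ^ k) (spectralMeasure s G) := by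
  rw [spectralMeasure]
  refine Integrable.smul_measure ?_ (ENNReal.inv_ne_top.2 (by simpa using hn))
  rw [integrable_finsetSum_measure]
  intro i _
  exact integrable_dirac (by simp)

/-- Walks in `G` are the walks in the complete graph with edges in `G`. -/
def walkEquiv {V : Type*} [Fintype V] [DecidableEq V] (G : SimpleGraph V) [DecidableRel G.Adj]
    (k : ℕ) (u v : V) : {p : G.Walk u v | p.length = k} ≃
      {w // w ∈ ((⊤ : SimpleGraph V).finsetWalkLength k u v).filter
        fun w => w.edges.toFinset ⊆ G.edgeFinset} where
  toFun p := ⟨p.1.transfer ⊤ fun e he => SimpleGraph.edgeSet_mono le_top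
      (p.1.edges_subset_edgeSet he), by
    rw [Finset.mem_filter, SimpleGraph.mem_finsetWalkLength_iff, SimpleGraph.Walk.length_transfer,
      SimpleGraph.Walk.edges_transfer]
    refine ⟨p.2, fun e he => ?_⟩
    rw [SimpleGraph.mem_edgeFinset]
    exact p.1.edges_subset_edgeSet (List.mem_toFinset.1 he)⟩
  invFun w := ⟨w.1.transfer G fun e he => SimpleGraph.mem_edgeFinset.1
      ((Finset.mem_filter.1 w.2).2 (List.mem_toFinset.2 he)), by
    change (w.1.transfer G _).length = k
    rw [SimpleGraph.Walk.length_transfer]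
    exact SimpleGraph.mem_finsetWalkLength_iff.1 (Finset.mem_filter.1 w.2).1⟩
  left_inv p := by
    apply Subtype.ext
    exact (SimpleGraph.Walk.transfer_transfer _ _ _).trans (SimpleGraph.Walk.transfer_self _)
  right_inv w := by
    apply Subtype.ext
    exact (SimpleGraph.Walk.transfer_transfer _ _ _).trans (SimpleGraph.Walk.transfer_self _)

open Classical in
theorem trace_scaledAdjMatrix_pow {n : ℕ} (s : ℝ) (G : SimpleGraph (Fin n)) (k : ℕ) :
    (scaledAdjMatrix s G ^ k).trace = s ^ k *
      ∑ w ∈ closedWalks (Fin n) k, if w.2.edges.toFinset ⊆ G.edgeFinset then 1 else 0 := by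
  rw [scaledAdjMatrix, _root_.smul_pow, Matrix.trace_smul, smul_eq_mul, Matrix.trace, closedWalks,
    Finset.sum_sigma]
  congr 1
  refine Finset.sum_congr rfl fun r _ => ?_
  rw [Matrix.diag_apply]
  have h := G.adjMatrix_pow_apply_eq_card_walk (α := ℝ) k r r
  rw [Fintype.card_congr (walkEquiv G k r r), Fintype.card_coe] at h
  rw [Finset.sum_boole]
  convert h

/-- The probability that a binomial random subset of `T` contains `E`: the elements of `T \ E` are
free and contribute total mass `1`. -/
theorem sum_Icc_pow_mul {α : Type*} [DecidableEq α] (p : ℝ) {E T : Finset α} (h : E ⊆ T) :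
    ∑ S ∈ Finset.Icc E T, p ^ S.card * (1 - p) ^ (T.card - S.card) = p ^ E.card := by
  rw [Finset.Icc_eq_image_powerset h, Finset.sum_image]
  · have h1 : ∀ S ∈ (T \ E).powerset, p ^ (E ∪ S).card * (1 - p) ^ (T.card - (E ∪ S).card) =
        p ^ E.card * (p ^ S.card * (1 - p) ^ ((T \ E).card - S.card)) := by
      intro S hS
      rw [Finset.mem_powerset] at hS
      have hd : Disjoint E S := (Finset.disjoint_sdiff).mono_right hS
      rw [Finset.card_union_of_disjoint hd, Finset.card_sdiff_of_subset h, pow_add, mul_assoc,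
        Nat.sub_add_eq]
    rw [Finset.sum_congr rfl h1, ← Finset.mul_sum, Finset.sum_pow_mul_eq_add_pow]
    simp
  · intro S hS S' hS' heq
    have hS := Finset.mem_powerset.1 (Finset.mem_coe.1 hS)
    have hS' := Finset.mem_powerset.1 (Finset.mem_coe.1 hS')
    have hd : Disjoint E S := (Finset.disjoint_sdiff).mono_right hS
    have hd' : Disjoint E S' := (Finset.disjoint_sdiff).mono_right hS'
    have heq : E ∪ S = E ∪ S' := heq
    rw [← hd.sup_sdiff_cancel_left, ← hd'.sup_sdiff_cancel_left]
    simpa using congrArg (· \ E) heq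

open Classical in
theorem sum_binomialRandom {n : ℕ} (p : unitInterval) {E : Finset (Sym2 (Fin n))}
    (hE : ∀ e ∈ E, ¬ e.IsDiag) :
    ∑ G : SimpleGraph (Fin n), (SimpleGraph.binomialRandom (Fin n) p {G}).toReal *
      (if E ⊆ G.edgeFinset then 1 else 0) = (p : ℝ) ^ E.card := by
  have hT : ∀ S : Finset (Sym2 (Fin n)), S ⊆ (⊤ : SimpleGraph (Fin n)).edgeFinset ↔
      ∀ e ∈ S, ¬ e.IsDiag := by
    intro S
    simp [Finset.subset_iff]
  rw [← sum_Icc_pow_mul (p : ℝ) ((hT E).2 hE)]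
  simp only [mul_ite, mul_one, mul_zero]
  rw [← Finset.sum_filter]
  refine Finset.sum_bij (fun G _ => G.edgeFinset) ?_ ?_ ?_ ?_
  · intro G hG
    rw [Finset.mem_Icc]
    exact ⟨(Finset.mem_filter.1 hG).2, SimpleGraph.edgeFinset_mono le_top⟩
  · intro G _ G' _ h
    exact SimpleGraph.edgeFinset_inj.1 h
  · intro S hS
    rw [Finset.mem_Icc] at hS
    have h : ∀ _ : Fintype (SimpleGraph.fromEdgeSet (S : Set (Sym2 (Fin n)))).edgeSet,
        (SimpleGraph.fromEdgeSet (S : Set (Sym2 (Fin n)))).edgeFinset = S := by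
      intro _
      ext e
      rw [SimpleGraph.mem_edgeFinset, SimpleGraph.edgeSet_fromEdgeSet]
      simp only [Set.mem_sdiff, Finset.mem_coe, and_iff_left_iff_imp]
      exact fun he => (hT S).1 hS.2 e he
    exact ⟨SimpleGraph.fromEdgeSet (S : Set (Sym2 (Fin n))),
      Finset.mem_filter.2 ⟨Finset.mem_univ _, by rw [h]; exact hS.1⟩, h _⟩
  · intro G _
    rw [SimpleGraph.binomialRandom_singleton, SimpleGraph.card_edgeFinset_top_eq_card_choose_two,
      Nat.card_eq_fintype_card, ← SimpleGraph.coe_edgeFinset, Set.ncard_coe_finset]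
    simp

theorem integral_pow_meanSpectralMeasure (p : ℝ[X]) {c : ℝ} (hc : 0 < c) {n : ℕ} (hn : n ≠ 0)
    (hcn : c ≤ n) (k : ℕ) :
    ∫ x, x ^ k ∂(meanSpectralMeasure p c n) = (Real.sqrt (c * p.eval c⁻¹))⁻¹ ^ k * ((n : ℝ)⁻¹ *
      ∑ w ∈ closedWalks (Fin n) k, (c / n) ^ w.2.edges.toFinset.card) := by
  classical
  have hn' : (0 : ℝ) < n := by positivity
  have hmem : c / n ∈ Set.Icc (0 : ℝ) 1 := ⟨by positivity, (div_le_one hn').2 hcn⟩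
  have hne : ∀ G : SimpleGraph (Fin n), SimpleGraph.binomialRandom (Fin n)
      (Set.projIcc (0 : ℝ) 1 zero_le_one (c / n)) {G} ≠ ⊤ := fun G => measure_ne_top _ _
  rw [meanSpectralMeasure, integral_finsetSum_measure]
  · simp only [integral_smul_measure, integral_pow_spectralMeasure, trace_scaledAdjMatrix_pow,
      smul_eq_mul]
    set s := (Real.sqrt (c * p.eval c⁻¹))⁻¹
    rw [Set.projIcc_of_mem zero_le_one hmem]
    set q : unitInterval := ⟨c / n, hmem⟩ with hq
    have h1 : ∀ w ∈ closedWalks (Fin n) k, (c / n) ^ w.2.edges.toFinset.card =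
        ∑ G : SimpleGraph (Fin n), (SimpleGraph.binomialRandom (Fin n) q {G}).toReal *
          (if w.2.edges.toFinset ⊆ G.edgeFinset then 1 else 0) := by
      intro w _
      rw [sum_binomialRandom q]
      intro e he
      exact SimpleGraph.not_isDiag_of_mem_edgeSet _
        (w.2.edges_subset_edgeSet (List.mem_toFinset.1 he))
    rw [Finset.sum_congr rfl h1, Finset.sum_comm, Finset.mul_sum, Finset.mul_sum]
    refine Finset.sum_congr rfl fun G _ => ?_
    rw [← Finset.mul_sum]
    ring
  · intro G _
    exact (integrable_pow_spectralMeasure hn _ G k).smul_measure (hne G)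

theorem tendsto_choose_mul_pow (c : ℝ) {m e : ℕ} (h : m ≤ e + 1) :
    Tendsto (fun n : ℕ => (n : ℝ)⁻¹ * ((n.choose m : ℝ) * (c / n) ^ e)) atTop
      (𝓝 (if e + 1 = m then c ^ e / m.factorial else 0)) := by
  have h1 : Tendsto (fun n : ℕ => (n.choose m : ℝ) / (n : ℝ) ^ m) atTop
      (𝓝 ((m.factorial : ℝ)⁻¹)) := by
    -- The asymptotics of `n.choose m` come from the Poisson limit with success probability `1/n`,
    -- whose mean tends to `1`.
    have h0 : Tendsto (fun n : ℕ => (n : ℝ) * (n : ℝ)⁻¹) atTop (𝓝 1) := by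
      refine tendsto_const_nhds.congr' ?_
      filter_upwards [eventually_ne_atTop 0] with n hn
      exact (mul_inv_cancel₀ (Nat.cast_ne_zero.2 hn)).symm
    have := ProbabilityTheory.tendsto_choose_mul_pow_atTop m h0
    simpa [div_eq_mul_inv] using this
  obtain ⟨d, hd⟩ := Nat.exists_eq_add_of_le h
  have h2 : Tendsto (fun n : ℕ => ((n : ℝ)⁻¹) ^ d) atTop (𝓝 (if d = 0 then 1 else 0)) := by
    split_ifs with h
    · simp [h]
    · have := (tendsto_inv_atTop_nhds_zero_nat (𝕜 := ℝ)).pow d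
      rwa [zero_pow h] at this
  have h3 := ((h1.mul h2).const_mul (c ^ e))
  have h4 : c ^ e * ((m.factorial : ℝ)⁻¹ * if d = 0 then 1 else 0) =
      if e + 1 = m then c ^ e / m.factorial else 0 := by
    by_cases hd0 : d = 0
    · rw [if_pos hd0, if_pos (by omega), mul_one, div_eq_mul_inv]
    · rw [if_neg hd0, if_neg (by omega), mul_zero, mul_zero]
  rw [← h4]
  refine h3.congr' ?_
  filter_upwards [eventually_gt_atTop 0] with n hn
  have hn' : (n : ℝ) ≠ 0 := by positivity
  have h5 : (n : ℝ) ^ m * (n : ℝ) ^ d = n ^ e * n := by rw [← pow_add, ← hd, pow_succ]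
  have h6 : ((n : ℝ) ^ m)⁻¹ * ((n : ℝ) ^ d)⁻¹ = ((n : ℝ) ^ e)⁻¹ * (n : ℝ)⁻¹ := by
    rw [← mul_inv, ← mul_inv, h5]
  rw [div_pow, inv_pow, div_eq_mul_inv, div_eq_mul_inv]
  linear_combination c ^ e * (n.choose m : ℝ) * h6

theorem tendsto_sum_closedWalks {c : ℝ} (hc : c ≠ 0) (k : ℕ) :
    Tendsto (fun n : ℕ => (n : ℝ)⁻¹ *
      ∑ w ∈ closedWalks (Fin n) k, (c / n) ^ w.2.edges.toFinset.card) atTop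
      (𝓝 (∑ m ∈ Finset.range (k + 2),
        (treeWalkCount m k : ℝ) / m.factorial * (c⁻¹ * c ^ m))) := by
  have h1 : ∀ n : ℕ, (n : ℝ)⁻¹ *
      ∑ w ∈ closedWalks (Fin n) k, (c / n) ^ w.2.edges.toFinset.card =
      ∑ m ∈ Finset.range (k + 2), ∑ e ∈ Finset.range (k + 1),
        (coveringWalkCount m e k : ℝ) * ((n : ℝ)⁻¹ * ((n.choose m : ℝ) * (c / n) ^ e)) := by
    intro n
    rw [sum_closedWalks n k fun _ e => (c / n : ℝ) ^ e, Finset.mul_sum]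
    refine Finset.sum_congr rfl fun m _ => ?_
    rw [Finset.mul_sum]
    refine Finset.sum_congr rfl fun e _ => ?_
    push_cast
    ring
  simp only [h1]
  refine tendsto_finsetSum _ fun m hm => ?_
  have h2 : (treeWalkCount m k : ℝ) / m.factorial * (c⁻¹ * c ^ m) =
      ∑ e ∈ Finset.range (k + 1), (coveringWalkCount m e k : ℝ) *
        (if e + 1 = m then c ^ e / m.factorial else 0) := by
    cases m with
    | zero => simp [treeWalkCount_zero]
    | succ m =>
      rw [Finset.sum_eq_single m]
      · rw [if_pos rfl, treeWalkCount_succ, pow_succ']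
        field_simp
      · intro e _ he
        rw [if_neg (by omega), mul_zero]
      · intro h
        simp at h hm
        omega
  rw [h2]
  refine tendsto_finsetSum _ fun e _ => ?_
  by_cases h : m ≤ e + 1
  · exact (tendsto_choose_mul_pow c h).const_mul _
  · simp [coveringWalkCount_eq_zero (not_le.1 h)]

theorem tendsto_moment (p : ℝ[X]) {c : ℝ} (hc : 0 < c) (k : ℕ) :
    Tendsto (fun n : ℕ => ∫ x, x ^ k ∂(meanSpectralMeasure p c n)) atTop
      (𝓝 ((Real.sqrt (c * p.eval c⁻¹))⁻¹ ^ k * ∑ m ∈ Finset.range (k + 2),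
        (treeWalkCount m k : ℝ) / m.factorial * (c⁻¹ * c ^ m))) := by
  refine ((tendsto_sum_closedWalks hc.ne' k).const_mul _).congr' ?_
  filter_upwards [eventually_ne_atTop 0, eventually_ge_atTop ⌈c⌉₊] with n hn hcn
  exact (integral_pow_meanSpectralMeasure p hc hn (Nat.ceil_le.1 hcn) k).symm

theorem tendsto_even_moment (p : ℝ[X]) {c : ℝ} (hc : 0 < c) (hp : 0 < p.eval c⁻¹) (l : ℕ) :
    Tendsto (fun n : ℕ => ∫ x, x ^ (2 * l) ∂(meanSpectralMeasure p c n)) atTop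
      (𝓝 ((evenMoment l).eval c⁻¹ / (p.eval c⁻¹) ^ l)) := by
  have h := tendsto_moment p hc (2 * l)
  rw [sum_treeWalkCount_even hc.ne', ← evenMoment_eq_visitCoeff, pow_mul, inv_pow,
    Real.sq_sqrt (by positivity), mul_inv, mul_pow, inv_pow, inv_pow] at h
  convert h using 2
  have : c ^ l ≠ 0 := by positivity
  field_simp

theorem tendsto_odd_moment (p : ℝ[X]) {c : ℝ} (hc : 0 < c) (l : ℕ) :
    Tendsto (fun n : ℕ => ∫ x, x ^ (2 * l + 1) ∂(meanSpectralMeasure p c n)) atTop (𝓝 0) := by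
  have h := tendsto_moment p hc (2 * l + 1)
  rwa [sum_treeWalkCount_odd hc.ne', mul_zero] at h

end Spectral

/-! ### The expansion in `1/c` -/

section Uniqueness

variable {S : Type*} [CommRing S]

/-- A truncated solution of the equations of the visit series is unique. -/
theorem pow_dvd_sub_of_recursion {t w : S} (hw : ∀ s, IsUnit (1 - w * s)) {M : ℕ} {a b : ℕ → S}
    (h0 : a 0 = b 0)
    (ha : ∀ j < M, t ^ (M - j) ∣ a (j + 1) - (a j + w * ∑ i ∈ Finset.range (M - j),
      ((i + j).choose i : S) * (t * w) ^ i * (a (i + 1) * a (j + 1 + i))))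
    (hb : ∀ j < M, t ^ (M - j) ∣ b (j + 1) - (b j + w * ∑ i ∈ Finset.range (M - j),
      ((i + j).choose i : S) * (t * w) ^ i * (b (i + 1) * b (j + 1 + i))))
    (o j : ℕ) (hoj : j + o ≤ M + 1) : t ^ o ∣ a j - b j := by
  induction o using Nat.strong_induction_on generalizing j with
  | _ o iho =>
  rcases o with _ | o
  · simp
  -- The summands with `i ≥ 1` carry `t ^ i` and need agreement only to lower orders, which the
  -- induction supplies. The summand `i = 0` stays, linearized in the differences.
  have step : ∀ j, j + 1 + (o + 1) ≤ M + 1 → t ^ (o + 1) ∣ (a (j + 1) - b (j + 1)) -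
      (a j - b j) - w * ((a 1 - b 1) * a (j + 1) + b 1 * (a (j + 1) - b (j + 1))) := by
    intro j hj
    have h1 : t ^ (o + 1) ∣ _ := (pow_dvd_pow t (by omega)).trans
      (dvd_sub (ha j (by omega)) (hb j (by omega)))
    obtain ⟨L, hL⟩ : ∃ L, M - j = L + 1 := ⟨M - j - 1, by omega⟩
    rw [hL, Finset.sum_range_succ', Finset.sum_range_succ'] at h1
    have h2 : t ^ (o + 1) ∣ ∑ i ∈ Finset.range L, ((i + 1 + j).choose (i + 1) : S) *
        (t * w) ^ (i + 1) * (a (i + 1 + 1) * a (j + 1 + (i + 1)) -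
          b (i + 1 + 1) * b (j + 1 + (i + 1))) := by
      refine Finset.dvd_sum fun i hi => ?_
      rw [Finset.mem_range] at hi
      by_cases hio : o ≤ i
      · refine Dvd.dvd.mul_right (Dvd.dvd.mul_left ?_ _) _
        rw [mul_pow]
        exact (pow_dvd_pow t (by omega)).mul_right _
      · have e1 := iho (o - i) (by omega) (i + 1 + 1) (by omega)
        have e2 := iho (o - i) (by omega) (j + 1 + (i + 1)) (by omega)
        have e3 : t ^ (o - i) ∣ a (i + 1 + 1) * a (j + 1 + (i + 1)) -
            b (i + 1 + 1) * b (j + 1 + (i + 1)) := by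
          have := dvd_add (e1.mul_right (a (j + 1 + (i + 1)))) (e2.mul_left (b (i + 1 + 1)))
          convert this using 1
          ring
        rw [show o + 1 = (i + 1) + (o - i) by omega, pow_add]
        refine mul_dvd_mul (Dvd.dvd.mul_left ?_ _) e3
        rw [mul_pow]
        exact dvd_mul_right _ _
    have h3 := dvd_add h1 (h2.mul_left w)
    convert h3 using 1
    simp only [mul_sub, Finset.sum_sub_distrib]
    simp only [zero_add, Nat.choose_zero_right, Nat.cast_one, pow_zero, one_mul, add_zero]
    ring
  -- For `j = 0` the relation reads `(a 1 - b 1) * (1 - w * (a 1 + b 1)) ≡ 0`, with a unit as second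
  -- factor.
  have hone : ∀ j, j + 1 + (o + 1) ≤ M + 1 → t ^ (o + 1) ∣ a 1 - b 1 := by
    intro j hj
    have h1 := step 0 (by omega)
    rw [h0, sub_self, sub_zero, zero_add] at h1
    refine ((hw (a 1 + b 1)).dvd_mul_right).1 ?_
    convert h1 using 1
    ring
  induction j with
  | zero => simp [h0]
  | succ j ihj =>
    have h1 := dvd_add (dvd_add (step j hoj) (ihj (by omega)))
      (((hone j hoj).mul_right (a (j + 1))).mul_left w)
    refine ((hw (b 1)).dvd_mul_right).1 ?_
    convert h1 using 1
    ring

end Uniqueness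

section Expansion

/-- The expansion of the `j`-th visit series, divided by `C ^ j`, for the scaling `p₅`, up to the
order `6 - j` in `t = 1/c`, with `x = z C(z)²`. -/
def visitPoly {S : Type*} [CommRing S] (x t : S) : ℕ → S
  | 0 => 1
  | 1 =>
    1 + (-x) * t + (-2 * x ^ 3) * t ^ 2 + (-3 * x - 2 * x ^ 2 + 2 * x ^ 3 - x ^ 4 - 11 * x ^ 5)
    * t ^ 3 + (-26 * x - 20 * x ^ 2 - 23 * x ^ 3 - 17 * x ^ 4 + 19 * x ^ 5 - 27 * x ^ 6 - 90 *
    x ^ 7) * t ^ 4 + (-324 * x - 266 * x ^ 2 - 249 * x ^ 3 - 239 * x ^ 4 - 301 * x ^ 5 - 166 *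
    x ^ 6 + 163 * x ^ 7 - 529 * x ^ 8 - 931 * x ^ 9) * t ^ 5
  | 2 =>
    1 + (-2 * x + x ^ 2) * t + (-x ^ 2 - 8 * x ^ 3 + 5 * x ^ 4) * t ^ 2 + (-6 * x - 3 * x ^ 2 +
    10 * x ^ 3 - 16 * x ^ 4 - 52 * x ^ 5 + 40 * x ^ 6) * t ^ 3 + (-52 * x - 40 * x ^ 2 - 60 * x
    ^ 3 - 14 * x ^ 4 + 126 * x ^ 5 - 280 * x ^ 6 - 410 * x ^ 7 + 413 * x ^ 8) * t ^ 4
  | 3 =>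
    1 + (-3 * x + 3 * x ^ 2) * t + (-3 * x ^ 2 - 20 * x ^ 3 + 21 * x ^ 4) * t ^ 2 + (-9 * x - 3
    * x ^ 2 + 26 * x ^ 3 - 63 * x ^ 4 - 162 * x ^ 5 + 206 * x ^ 6) * t ^ 3
  | 4 =>
    1 + (-4 * x + 6 * x ^ 2) * t + (-6 * x ^ 2 - 40 * x ^ 3 + 57 * x ^ 4) * t ^ 2
  | 5 =>
    1 + (-5 * x + 10 * x ^ 2) * t
  | 6 =>
    1
  -- From index `7` on nothing is required: there the precision is `t ^ 0` or none.
  | _ => 0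

variable {S : Type*} [CommRing S]

/-- Powers of `1 / p₅(t)` modulo `t ^ 6`; the polynomial multipliers of `ht` below collect the
overflow beyond `t ^ 5`. -/
theorem inv_scaling_pow {t q : S} (ht : t ^ 6 = 0)
    (hq : q * (1 + t + t ^ 2 + 4 * t ^ 3 + 33 * t ^ 4 + 386 * t ^ 5) = 1) :
    q ^ 1 = 1 - t - 3 * t ^ 3 - 26 * t ^ 4 - 324 * t ^ 5 ∧
    q ^ 2 = 1 - 2 * t + t ^ 2 - 6 * t ^ 3 - 46 * t ^ 4 - 596 * t ^ 5 ∧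
    q ^ 3 = 1 - 3 * t + 3 * t ^ 2 - 10 * t ^ 3 - 60 * t ^ 4 - 825 * t ^ 5 ∧
    q ^ 4 = 1 - 4 * t + 6 * t ^ 2 - 16 * t ^ 3 - 67 * t ^ 4 - 1020 * t ^ 5 ∧
    q ^ 5 = 1 - 5 * t + 10 * t ^ 2 - 25 * t ^ 3 - 65 * t ^ 4 - 1191 * t ^ 5 ∧
    q ^ 6 = 1 - 6 * t + 15 * t ^ 2 - 38 * t ^ 3 - 51 * t ^ 4 - 1350 * t ^ 5 := by
  have h1 : q = 1 - t - 3 * t ^ 3 - 26 * t ^ 4 - 324 * t ^ 5 := by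
    linear_combination (exp := 1) (1 - t - 3 * t ^ 3 - 26 * t ^ 4 - 324 * t ^ 5) * hq - q * (-748 - 527 * t - 3312 * t ^ 2 - 20728 * t ^ 3 - 125064 * t ^ 4) * ht
  have h2 : q ^ 2 = 1 - 2 * t + t ^ 2 - 6 * t ^ 3 - 46 * t ^ 4 - 596 * t ^ 5 := by
    rw [sq, h1]
    linear_combination (657 + 156 * t + 2620 * t ^ 2 + 16848 * t ^ 3 + 104976 * t ^ 4) * ht
  have h3 : q ^ 3 = 1 - 3 * t + 3 * t ^ 2 - 10 * t ^ 3 - 60 * t ^ 4 - 825 * t ^ 5 := by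
    rw [pow_succ, h2, h1]
    linear_combination (1236 - 30 * t + 4928 * t ^ 2 + 30400 * t ^ 3 + 193104 * t ^ 4) * ht
  have h4 : q ^ 4 = 1 - 4 * t + 6 * t ^ 2 - 16 * t ^ 3 - 67 * t ^ 4 - 1020 * t ^ 5 := by
    rw [pow_succ, h3, h1]
    linear_combination (1749 - 532 * t + 7275 * t ^ 2 + 40890 * t ^ 3 + 267300 * t ^ 4) * ht
  have h5 : q ^ 5 = 1 - 5 * t + 10 * t ^ 2 - 25 * t ^ 3 - 65 * t ^ 4 - 1191 * t ^ 5 := by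
    rw [pow_succ, h4, h1]
    linear_combination (2208 - 1327 * t + 9986 * t ^ 2 + 48228 * t ^ 3 + 330480 * t ^ 4) * ht
  have h6 : q ^ 6 = 1 - 6 * t + 15 * t ^ 2 - 38 * t ^ 3 - 51 * t ^ 4 - 1350 * t ^ 5 := by
    rw [pow_succ, h5, h1]
    linear_combination (2626 - 2395 * t + 13363 * t ^ 2 + 52026 * t ^ 3 + 385884 * t ^ 4) * ht
  exact ⟨by rw [pow_one, h1], h2, h3, h4, h5, h6⟩

-- The moment equation after the ansatz `S_j = C ^ j * visitPoly x t j` and division by `C ^ j`. The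
-- remaining factor `C` on the left is `1 + x`, and each `z C²` becomes `x`.
set_option maxHeartbeats 4000000 in
theorem visitPoly_succ {x t q : S} {j : ℕ} (hj : j < 6) (ht : t ^ (6 - j) = 0)
    (hq : q * (1 + t + t ^ 2 + 4 * t ^ 3 + 33 * t ^ 4 + 386 * t ^ 5) = 1) :
    (1 + x) * visitPoly x t (j + 1) = visitPoly x t j + ∑ i ∈ Finset.range (6 - j),
      ((i + j).choose i : S) * t ^ i * (q * x) ^ (i + 1) *
        (visitPoly x t (i + 1) * visitPoly x t (j + 1 + i)) := by
  obtain ⟨h1, h2, h3, h4, h5, h6⟩ := inv_scaling_pow (pow_eq_zero_of_le (Nat.sub_le 6 j) ht) hq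
  interval_cases j <;>
  · simp only [Nat.reduceSub] at ht
    simp only [Finset.sum_range_succ, Finset.sum_range_zero, mul_pow, Nat.reduceAdd, Nat.reduceSub,
      h1, h2, h3, h4, h5, h6]
    simp only [visitPoly, Nat.choose]
    push_cast
    clear h1 h2 h3 h4 h5 h6 hq
    grind

end Expansion

/-! ### Reordering the expansion: powers of `1/c` outside, powers of `z` inside. -/

section Swap

variable {R : Type*} [CommRing R]

/-- Exchange the two variables of an iterated power series. -/
noncomputable def swapHom (R : Type*) [CommRing R] :
    PowerSeries (PowerSeries R) →+* PowerSeries (PowerSeries R) where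
  toFun f := PowerSeries.mk fun i => PowerSeries.mk fun n =>
    PowerSeries.coeff i (PowerSeries.coeff n f)
  map_one' := by
    ext i n
    simp only [PowerSeries.coeff_mk, PowerSeries.coeff_one]
    split_ifs <;> simp [PowerSeries.coeff_one, *]
  map_mul' f g := by
    ext i n
    simp only [PowerSeries.coeff_mk, PowerSeries.coeff_mul, map_sum]
    rw [Finset.sum_comm]
  map_zero' := by ext i n; simp
  map_add' f g := by ext i n; simp

theorem coeff_coeff_swapHom (f : PowerSeries (PowerSeries R)) (i n : ℕ) :
    PowerSeries.coeff n (PowerSeries.coeff i (swapHom R f)) =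
      PowerSeries.coeff i (PowerSeries.coeff n f) := by
  simp [swapHom]

theorem swapHom_X : swapHom R PowerSeries.X = PowerSeries.C PowerSeries.X := by
  ext i n
  rw [coeff_coeff_swapHom, PowerSeries.coeff_X, PowerSeries.coeff_C]
  split_ifs <;> simp [PowerSeries.coeff_one, PowerSeries.coeff_X, *]

theorem swapHom_C (f : PowerSeries R) :
    swapHom R (PowerSeries.C f) = PowerSeries.map PowerSeries.C f := by
  ext i n
  rw [coeff_coeff_swapHom, PowerSeries.coeff_C, PowerSeries.coeff_map, PowerSeries.coeff_C]
  split_ifs <;> simp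

/-- After the exchange, the truncation can be governed by the order in `t` instead of the order in
`z`, because the `i`-th summand carries `t ^ i`. -/
theorem X_pow_dvd_swapHom_visitSeries (q : PowerSeries R) {M j : ℕ} :
    (PowerSeries.X : PowerSeries (PowerSeries R)) ^ (M - j) ∣
      swapHom R (visitSeries (q * PowerSeries.X) q (j + 1)) -
        (swapHom R (visitSeries (q * PowerSeries.X) q j) +
          PowerSeries.map PowerSeries.C q * PowerSeries.C PowerSeries.X *
          ∑ i ∈ Finset.range (M - j), ((i + j).choose i : PowerSeries (PowerSeries R)) *
            (PowerSeries.X * (PowerSeries.map PowerSeries.C q * PowerSeries.C PowerSeries.X)) ^ i *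
            (swapHom R (visitSeries (q * PowerSeries.X) q (i + 1)) *
              swapHom R (visitSeries (q * PowerSeries.X) q (j + 1 + i)))) := by
  set w : PowerSeries (PowerSeries R) :=
    PowerSeries.map PowerSeries.C q * PowerSeries.C PowerSeries.X with hw
  set τ := fun k => swapHom R (visitSeries (q * PowerSeries.X) q k) with hτ
  set f : ℕ → PowerSeries (PowerSeries R) := fun i => ((i + j).choose i : PowerSeries
    (PowerSeries R)) * (PowerSeries.X * w) ^ i * (τ (i + 1) * τ (j + 1 + i)) with hf
  change _ ∣ τ (j + 1) - (τ j + w * ∑ i ∈ Finset.range (M - j), f i)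
  have hrec : ∀ N n o, n ≤ N → PowerSeries.coeff n (PowerSeries.coeff o (τ (j + 1))) =
      PowerSeries.coeff n (PowerSeries.coeff o (τ j + w * ∑ i ∈ Finset.range N, f i)) := by
    intro N n o hn
    have h1 : τ j + w * ∑ i ∈ Finset.range N, f i = swapHom R
        (visitSeries (q * PowerSeries.X) q j + PowerSeries.C q * PowerSeries.X *
        ∑ i ∈ Finset.range N, ((i + j).choose i : PowerSeries (PowerSeries R)) *
          (PowerSeries.C (q * PowerSeries.X) * PowerSeries.X) ^ i *
            (visitSeries (q * PowerSeries.X) q (i + 1) *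
              visitSeries (q * PowerSeries.X) q (j + 1 + i))) := by
      simp only [map_add, map_mul, map_sum, map_pow, map_natCast, swapHom_X, swapHom_C,
        PowerSeries.map_X, hf, hτ, hw]
      congr 2
      refine Finset.sum_congr rfl fun i _ => ?_
      ring
    rw [h1, coeff_coeff_swapHom, coeff_coeff_swapHom, coeff_visitSeries_succ _ _ _ hn]
  rw [PowerSeries.X_pow_dvd_iff]
  intro o ho
  rw [map_sub, sub_eq_zero]
  ext n
  -- The cutoff `M - j + n` is large enough to be exact at `z ^ n`; its last `n` summands are
  -- divisible by `t ^ (M - j)`.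
  rw [hrec (M - j + n) n o (by omega), Finset.sum_range_add, mul_add, ← add_assoc,
    map_add (PowerSeries.coeff o)]
  have hdvd : (PowerSeries.X : PowerSeries (PowerSeries R)) ^ (M - j) ∣
      w * ∑ i ∈ Finset.range n, f (M - j + i) := by
    refine Dvd.dvd.mul_left (Finset.dvd_sum fun i _ => ?_) _
    refine Dvd.dvd.mul_right (Dvd.dvd.mul_left ?_ _) _
    rw [mul_pow]
    exact (pow_dvd_pow _ (by omega)).mul_right _
  rw [PowerSeries.X_pow_dvd_iff.1 hdvd o ho, add_zero]

end Swap

/-! ### The coefficients of the expansion in terms of the Catalan series. -/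

section Main

/-- `z C(z)²`. -/
noncomputable def catalanVar : PowerSeries ℝ := PowerSeries.X * catalanGF ^ 2

theorem one_add_catalanVar : 1 + catalanVar = catalanGF := by
  have h := congrArg (PowerSeries.map (Nat.castRingHom ℝ))
    PowerSeries.catalanSeries_sq_mul_X_add_one
  rw [map_add, map_mul, map_pow, map_one, PowerSeries.map_X] at h
  rw [catalanVar, catalanGF]
  linear_combination h

theorem X_pow_dvd_catalan_visitPoly {q : PowerSeries (PowerSeries ℝ)}
    (hq : q * (1 + PowerSeries.X + PowerSeries.X ^ 2 + 4 * PowerSeries.X ^ 3 +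
      33 * PowerSeries.X ^ 4 + 386 * PowerSeries.X ^ 5) = 1)
    {b : ℕ → PowerSeries (PowerSeries ℝ)} (hb : ∀ j, b j = PowerSeries.C catalanGF ^ j *
      visitPoly (PowerSeries.C catalanVar) PowerSeries.X j) {j : ℕ} (hj : j < 6) :
    (PowerSeries.X : PowerSeries (PowerSeries ℝ)) ^ (6 - j) ∣ b (j + 1) -
      (b j + q * PowerSeries.C PowerSeries.X * ∑ i ∈ Finset.range (6 - j),
        ((i + j).choose i : PowerSeries (PowerSeries ℝ)) *
          (PowerSeries.X * (q * PowerSeries.C PowerSeries.X)) ^ i *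
            (b (i + 1) * b (j + 1 + i))) := by
  set c : PowerSeries (PowerSeries ℝ) := PowerSeries.C catalanGF with hc
  set x : PowerSeries (PowerSeries ℝ) := PowerSeries.C catalanVar with hx
  set z : PowerSeries (PowerSeries ℝ) := PowerSeries.C PowerSeries.X with hz
  have hxc : 1 + x = c := by rw [hx, hc, ← one_add_catalanVar, map_add, map_one]
  have hxz : x = z * c ^ 2 := by rw [hx, hz, hc, catalanVar, map_mul, map_pow]
  have hfac : b (j + 1) -
      (b j + q * z * ∑ i ∈ Finset.range (6 - j),
        ((i + j).choose i : PowerSeries (PowerSeries ℝ)) * (PowerSeries.X * (q * z)) ^ i *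
            (b (i + 1) * b (j + 1 + i))) =
      c ^ j * ((1 + x) * visitPoly x PowerSeries.X (j + 1) - (visitPoly x PowerSeries.X j +
        ∑ i ∈ Finset.range (6 - j), ((i + j).choose i : PowerSeries (PowerSeries ℝ)) *
          PowerSeries.X ^ i * (q * x) ^ (i + 1) *
        (visitPoly x PowerSeries.X (i + 1) * visitPoly x PowerSeries.X (j + 1 + i)))) := by
    simp only [hb, mul_sub, mul_add, Finset.mul_sum]
    rw [hxc]
    congr 1
    · ring
    · congr 1
      refine Finset.sum_congr rfl fun i _ => ?_
      rw [hxz, show j + 1 + i = j + (i + 1) by ring]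
      simp only [mul_pow, pow_add, ← pow_mul]
      ring
  rw [hfac]
  refine Dvd.dvd.mul_left ?_ _
  rw [← Ideal.mem_span_singleton, ← Ideal.Quotient.eq_zero_iff_mem]
  set I : Ideal (PowerSeries (PowerSeries ℝ)) :=
    Ideal.span {(PowerSeries.X : PowerSeries (PowerSeries ℝ)) ^ (6 - j)}
  have ht : (Ideal.Quotient.mk I PowerSeries.X) ^ (6 - j) = 0 := by
    rw [← map_pow]
    exact Ideal.Quotient.eq_zero_iff_mem.2 (Ideal.mem_span_singleton_self _)
  have hq' := congrArg (Ideal.Quotient.mk I) hq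
  simp only [map_add, map_mul, map_one, map_pow, map_ofNat] at hq'
  have hv : ∀ k, Ideal.Quotient.mk I (visitPoly x PowerSeries.X k) =
      visitPoly (Ideal.Quotient.mk I x) (Ideal.Quotient.mk I PowerSeries.X) k := by
    intro k
    unfold visitPoly
    split <;> simp only [map_add, map_sub, map_mul, map_one, map_pow, map_ofNat, map_neg, map_zero]
  have key := visitPoly_succ (x := Ideal.Quotient.mk I x) hj ht hq'
  simp only [map_add, map_sub, map_mul, map_one, map_pow, map_sum, map_natCast, hv]
  rw [key, sub_self]

theorem visitPoly_one_eq : visitPoly (PowerSeries.C catalanVar) PowerSeries.X 1 =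
    ∑ i : Fin 6, PowerSeries.C (Polynomial.aeval catalanVar (Q i)) *
      (PowerSeries.X : PowerSeries (PowerSeries ℝ)) ^ (i : ℕ) := by
  have hnat : ∀ (n : ℕ) [n.AtLeastTwo],
      PowerSeries.C (Polynomial.aeval catalanVar (OfNat.ofNat n : ℝ[X])) =
        (OfNat.ofNat n : PowerSeries (PowerSeries ℝ)) := fun n _ => by
    rw [map_ofNat, map_ofNat]
  simp [Fin.sum_univ_succ, Q, visitPoly, hnat]
  ring

theorem V_p5_eq (i : Fin 6) : V p5 i = catalanGF * Polynomial.aeval catalanVar (Q i) := by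
  set q : PowerSeries ℝ := (p5 : PowerSeries ℝ)⁻¹ with hq
  have hqp : q * (p5 : PowerSeries ℝ) = 1 := by
    refine PowerSeries.inv_mul_cancel _ ?_
    simp [p5]
  set Q' : PowerSeries (PowerSeries ℝ) := PowerSeries.map PowerSeries.C q with hQ'
  have hQp : Q' * (1 + PowerSeries.X + PowerSeries.X ^ 2 + 4 * PowerSeries.X ^ 3 +
      33 * PowerSeries.X ^ 4 + 386 * PowerSeries.X ^ 5) = 1 := by
    have h := congrArg (PowerSeries.map (PowerSeries.C (R := ℝ))) hqp
    rw [map_mul, map_one, ← Polynomial.coeToPowerSeries.ringHom_apply, p5] at h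
    simp only [map_add, map_mul, map_pow, map_one, map_ofNat] at h
    rwa [Polynomial.coeToPowerSeries.ringHom_apply, Polynomial.coe_X, PowerSeries.map_X] at h
  -- By homogeneity, replacing `z` by `q z` turns the parameters `(t, 1)` into `(q t, q)`.
  have hV : V p5 i = PowerSeries.coeff (i : ℕ)
      (swapHom ℝ (visitSeries (q * PowerSeries.X) q 1)) := by
    ext l
    rw [coeff_coeff_swapHom, V, PowerSeries.coeff_mk, scaledMomentSeries, PowerSeries.coeff_rescale,
      momentSeries, PowerSeries.coeff_mk, visitSeries, PowerSeries.coeff_mk,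
      evenMoment_eq_visitCoeff]
    have h := visitCoeff_map (Polynomial.coeToPowerSeries.ringHom (R := ℝ)) q
      (Polynomial.X : ℝ[X]) 1 l 1
    simp only [Polynomial.coeToPowerSeries.ringHom_apply, Polynomial.coe_X, Polynomial.coe_one,
      mul_one] at h
    rw [h]
  have hw : ∀ s, IsUnit (1 - Q' * PowerSeries.C PowerSeries.X * s) := by
    intro s
    rw [PowerSeries.isUnit_iff_constantCoeff, PowerSeries.isUnit_iff_constantCoeff]
    simp
  -- With `M = 6` the index `j = 1` is determined modulo `t ^ 6`, which covers the coefficients `i ≤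
  -- 5`.
  have huniq := pow_dvd_sub_of_recursion hw (M := 6)
    (a := fun j => swapHom ℝ (visitSeries (q * PowerSeries.X) q j))
    (b := fun j => PowerSeries.C catalanGF ^ j *
      visitPoly (PowerSeries.C catalanVar) PowerSeries.X j)
    (by simp [visitSeries_zero, visitPoly])
    (fun j _ => X_pow_dvd_swapHom_visitSeries q)
    (fun j hj => X_pow_dvd_catalan_visitPoly hQp (fun _ => rfl) hj) 6 1 le_rfl
  have hc := (PowerSeries.X_pow_dvd_iff.1 huniq) i i.2
  rw [map_sub, sub_eq_zero] at hc
  rw [hV, hc, pow_one, PowerSeries.coeff_C_mul, visitPoly_one_eq, map_sum]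
  congr 1
  rw [Finset.sum_eq_single i]
  · rw [PowerSeries.coeff_C_mul, PowerSeries.coeff_X_pow, if_pos rfl, mul_one]
  · intro k _ hk
    rw [PowerSeries.coeff_C_mul, PowerSeries.coeff_X_pow,
      if_neg fun h => hk (Fin.ext h.symm), mul_zero]
  · simp

end Main

end TreeWalks

/-- First part: for every scaling `p`, the moments of the mean spectral measures of
`(c p(1/c))^{-1/2} A(G(n, c/n))` converge as `n → ∞`; the limits are those recorded by
`scaledMomentSeries p`. Second part: the coefficients of `c^{-i}`, `i ≤ 5`, for `p = p₅`. -/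
theorem mainTheorem3 :
    (∀ (p : Polynomial ℝ) (c : ℝ), 0 < c → 0 < p.eval c⁻¹ → ∀ l : ℕ,
      Tendsto (fun n : ℕ => ∫ x, x ^ (2 * l) ∂(TreeWalks.meanSpectralMeasure p c n)) atTop
        (𝓝 ((TreeWalks.evenMoment l).eval c⁻¹ / (p.eval c⁻¹) ^ l)) ∧
      Tendsto (fun n : ℕ => ∫ x, x ^ (2 * l + 1) ∂(TreeWalks.meanSpectralMeasure p c n)) atTop
        (𝓝 0)) ∧
    (∀ i : Fin 6,
      TreeWalks.V TreeWalks.p5 i =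
        TreeWalks.catalanGF *
          Polynomial.aeval ((PowerSeries.X : PowerSeries ℝ) * TreeWalks.catalanGF ^ 2)
            (TreeWalks.Q i)) :=
  ⟨fun p _ hc hp l =>
      ⟨TreeWalks.tendsto_even_moment p hc hp l, TreeWalks.tendsto_odd_moment p hc l⟩,
    TreeWalks.V_p5_eq⟩
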